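/- Let $d,m\in\mathbb N$, let $\Omega\subset\mathbb R^d$ be a bounded domain (nonempty, open, connected), let $\sigma\ge 0$, and let $F,G:\Omega\times\mathbb R^m\times\mathbb R^d\to\mathbb R^d$, $b:\mathbb R^m\to\mathbb R^m$, $U_0:\Omega\times\mathbb R^m\to\mathbb R^d$ be Lipschitz continuous in all their variables. Fix a probability space carrying an $m$-dimensional Brownian motion. For $0<T<\infty$, a function $U:[0,T)\times\Omega\times\mathbb R^m\to\mathbb R^d$ is called a Lipschitz solution on $[0,T)$ of $$\partial_tU+F(x,p,U)\cdot\nabla_xU+b(p)\cdot\nabla_pU-\sigma\Delta_pU=G(x,p,U),\qquad U(0,\cdot)=U_0,$$ if $U$ is Lipschitz in $(x,p)$, uniformly in $t\in[0,\alpha]$, for every $\alpha\in[0,T)$, and if for all $t\in[0,T)$, $x\in\Omega$, $p\in\mathbb R^m$ and every $m$-dimensional Brownian motion $W$ on the probability space, $$U(t,x,p)=\mathbb E\Big[\int_0^tG\big(X_s,p_s,U(t-s,X_s,p_s)\big)\,ds+U_0(X_t,p_t)\Big],$$ where $(X_s,p_s)_{0\le s\le t}$ is a strong solution, with values in $\Omega\times\mathbb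 R^m$, of $$dX_s=-F\big(X_s,p_s,U(t-s,X_s,p_s)\big)\,ds,\quad dp_s=-b(p_s)\,ds+\sqrt{2\sigma}\,dW_s,\quad X_0=x,\ p_0=p$$ (existence of this solution and integrability of the quantities involved being part of the definition). For $f:\Omega\times\mathbb R^m\to\mathbb R^d$ write $$\|D_xf\|_\infty=\sup_{x\ne y\in\Omega,\ p\in\mathbb R^m}\frac{|f(x,p)-f(y,p)|}{|x-y|},\qquad \|D_pf\|_\infty=\sup_{x\in\Omega,\ p\ne q\in\mathbb R^m}\frac{|f(x,p)-f(x,q)|}{|p-q|}.$$ Then for every $T>0$ there exists a constant $C>0$ (depending on the data above and on $T$) such that for every Lipschitz solution $U$ on $[0,T)$ and every $t\in[0,T)$ the quantity $\sup_{s\in[0,t]}\|D_xU(s,\cdot)\|_\infty$ is finite and $$\sup_{s\in[0,t]}\|D_pU(s,\cdot)\|_\infty\le C\Big(1+\exp\Big(t\sup_{s\in[0,t]}\|D_xU(s,\cdot)\|_\infty\Big)\Big).$$ -/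

import Mathlib

open MeasureTheory ProbabilityTheory Set
open scoped NNReal ENNReal

/-- `W` is an `m`-dimensional standard Brownian motion under `P`: its coordinates are independent
real Brownian motions (with almost surely continuous paths). -/
structure IsBrownianMotion {m : ℕ} {S : Type*} [MeasurableSpace S]
    (W : ℝ≥0 → S → EuclideanSpace ℝ (Fin m)) (P : Measure S) : Prop where
  measurable : ∀ t, Measurable (W t)
  coord : ∀ i : Fin m, IsBrownianReal (fun t ω => W t ω i) P
  indep : iIndepFun (fun (i : Fin m) (ω : S) (t : ℝ≥0) => W t ω i) P

/-- The information `σ(W_r, r ≤ s)` generated by the Brownian motion up to time `s`. -/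
@[reducible] def pastOf {m : ℕ} {S : Type*} (W : ℝ≥0 → S → EuclideanSpace ℝ (Fin m)) (s : ℝ) :
    MeasurableSpace S :=
  ⨆ r : ℝ≥0, ⨆ _ : (r : ℝ) ≤ s, MeasurableSpace.comap (W r) inferInstance

/-- `(X, p)` is, on `[0, t]`, a strong solution with values in `Ω × ℝᵐ` of the system
`dX_s = -B(t - s, X_s, p_s) ds`, `dp_s = -b(p_s) ds + √(2σ) dW_s`, `X_0 = x`, `p_0 = q`.
Adaptedness is understood up to `P`-null sets. -/
structure IsCharacteristic {d m : ℕ} {S : Type*} [MeasurableSpace S] (P : Measure S)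
    (W : ℝ≥0 → S → EuclideanSpace ℝ (Fin m)) (Ω : Set (EuclideanSpace ℝ (Fin d))) (σ : ℝ)
    (b : EuclideanSpace ℝ (Fin m) → EuclideanSpace ℝ (Fin m))
    (B : ℝ → EuclideanSpace ℝ (Fin d) → EuclideanSpace ℝ (Fin m) → EuclideanSpace ℝ (Fin d))
    (t : ℝ) (x : EuclideanSpace ℝ (Fin d)) (q : EuclideanSpace ℝ (Fin m))
    (X : ℝ → S → EuclideanSpace ℝ (Fin d)) (p : ℝ → S → EuclideanSpace ℝ (Fin m)) : Prop where
  adapted_X : ∀ s ∈ Icc 0 t, AEStronglyMeasurable[pastOf W s] (X s) P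
  adapted_p : ∀ s ∈ Icc 0 t, AEStronglyMeasurable[pastOf W s] (p s) P
  mem : ∀ᵐ ω ∂P, ∀ s ∈ Icc 0 t, X s ω ∈ Ω
  integrable_X : ∀ᵐ ω ∂P,
    IntervalIntegrable (fun s => B (t - s) (X s ω) (p s ω)) volume 0 t
  integrable_p : ∀ᵐ ω ∂P, IntervalIntegrable (fun s => b (p s ω)) volume 0 t
  eq_X : ∀ᵐ ω ∂P, ∀ s ∈ Icc 0 t,
    X s ω = x - ∫ r in (0 : ℝ)..s, B (t - r) (X r ω) (p r ω)
  eq_p : ∀ᵐ ω ∂P, ∀ s ∈ Icc 0 t,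
    p s ω = q - (∫ r in (0 : ℝ)..s, b (p r ω)) + Real.sqrt (2 * σ) • W s.toNNReal ω

/-- `V = ψ(T, A, B, U₀)` on `[0, T) × Ω × ℝᵐ`: the Feynman–Kac representation
`V(t, x, q) = 𝔼[∫₀ᵗ A(t - s, X_s, p_s) ds + U₀(X_t, p_t) | X_0 = x, p_0 = q]`,
where `(X, p)` is the characteristic driven by a Brownian motion on the probability space. The
expectation does not depend on which Brownian motion is used, so it is given by this formula for
each of them. -/
def IsFeynmanKac {d m : ℕ} {S : Type*} [MeasurableSpace S] (P : Measure S)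
    (Ω : Set (EuclideanSpace ℝ (Fin d))) (σ : ℝ)
    (b : EuclideanSpace ℝ (Fin m) → EuclideanSpace ℝ (Fin m)) (T : ℝ)
    (A B : ℝ → EuclideanSpace ℝ (Fin d) → EuclideanSpace ℝ (Fin m) → EuclideanSpace ℝ (Fin d))
    (U₀ : EuclideanSpace ℝ (Fin d) → EuclideanSpace ℝ (Fin m) → EuclideanSpace ℝ (Fin d))
    (V : ℝ → EuclideanSpace ℝ (Fin d) → EuclideanSpace ℝ (Fin m) → EuclideanSpace ℝ (Fin d)) :
    Prop :=
  ∀ t ∈ Ico 0 T, ∀ x ∈ Ω, ∀ q : EuclideanSpace ℝ (Fin m),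
    ∀ W : ℝ≥0 → S → EuclideanSpace ℝ (Fin m), IsBrownianMotion W P →
      ∃ (X : ℝ → S → EuclideanSpace ℝ (Fin d)) (p : ℝ → S → EuclideanSpace ℝ (Fin m)),
        IsCharacteristic P W Ω σ b B t x q X p ∧
        (∀ᵐ ω ∂P, IntervalIntegrable (fun s => A (t - s) (X s ω) (p s ω)) volume 0 t) ∧
        Integrable
          (fun ω => (∫ s in (0 : ℝ)..t, A (t - s) (X s ω) (p s ω)) + U₀ (X t ω) (p t ω)) P ∧
        V t x q =
          ∫ ω, ((∫ s in (0 : ℝ)..t, A (t - s) (X s ω) (p s ω)) + U₀ (X t ω) (p t ω)) ∂P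

/-- `U` is a Lipschitz solution on `[0, T)` of
`∂ₜU + F(x,p,U)·∇ₓU + b(p)·∇ₚU - σ Δₚ U = G(x,p,U)`, `U(0, ·) = U₀`, in `Ω × ℝᵐ`. -/
structure IsLipschitzSolution {d m : ℕ} {S : Type*} [MeasurableSpace S] (P : Measure S)
    (Ω : Set (EuclideanSpace ℝ (Fin d))) (σ : ℝ)
    (b : EuclideanSpace ℝ (Fin m) → EuclideanSpace ℝ (Fin m))
    (F G : EuclideanSpace ℝ (Fin d) → EuclideanSpace ℝ (Fin m) → EuclideanSpace ℝ (Fin d) →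
      EuclideanSpace ℝ (Fin d))
    (U₀ : EuclideanSpace ℝ (Fin d) → EuclideanSpace ℝ (Fin m) → EuclideanSpace ℝ (Fin d))
    (T : ℝ)
    (U : ℝ → EuclideanSpace ℝ (Fin d) → EuclideanSpace ℝ (Fin m) → EuclideanSpace ℝ (Fin d)) :
    Prop where
  lipschitz : ∀ α ∈ Ico 0 T, ∃ K : ℝ≥0, ∀ t ∈ Icc 0 α,
    LipschitzOnWith K
      (fun z : EuclideanSpace ℝ (Fin d) × EuclideanSpace ℝ (Fin m) => U t z.1 z.2) (Ω ×ˢ univ)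
  feynmanKac : IsFeynmanKac P Ω σ b T
    (fun t x p => G x p (U t x p)) (fun t x p => F x p (U t x p)) U₀ U

/-- `‖D_x f‖_∞`: the least Lipschitz constant in `x`, uniform in `p`, as an element of
`[0, ∞]`. -/
noncomputable def lipX {d m : ℕ} (Ω : Set (EuclideanSpace ℝ (Fin d)))
    (f : EuclideanSpace ℝ (Fin d) → EuclideanSpace ℝ (Fin m) → EuclideanSpace ℝ (Fin d)) :
    ℝ≥0∞ :=
  ⨆ (x ∈ Ω) (y ∈ Ω) (_ : x ≠ y) (p : EuclideanSpace ℝ (Fin m)),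
    edist (f x p) (f y p) / edist x y

/-- `‖D_p f‖_∞`: the least Lipschitz constant in `p`, uniform in `x ∈ Ω`, as an element of
`[0, ∞]`. -/
noncomputable def lipP {d m : ℕ} (Ω : Set (EuclideanSpace ℝ (Fin d)))
    (f : EuclideanSpace ℝ (Fin d) → EuclideanSpace ℝ (Fin m) → EuclideanSpace ℝ (Fin d)) :
    ℝ≥0∞ :=
  ⨆ (x ∈ Ω) (p : EuclideanSpace ℝ (Fin m)) (q : EuclideanSpace ℝ (Fin m)) (_ : p ≠ q),
    edist (f x p) (f x q) / edist p q

/-! ### Grönwall inequalities in integral form -/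

/-! Let `L` be a Lipschitz constant of `F` and `G`, `β` one of `b`, and let `M` and `N(t)` be the
suprema over `[0, t]` of `‖D_x U‖_∞` and `‖D_p U‖_∞`. Two characteristics started at `(x, q)` and
`(x, q')` with the same noise differ after a short time `h` by at most a factor `exp (β h)` in `p`
and by `O(h L (1 + N))` in `X`, relative to `‖q - q'‖`. Restarting the representation at time `h`
turns this into a discrete differential inequality for `1 + N`, with rate `β + 4 L (2 + M)`
(`IsFeynmanKac.norm_sub_le_step`, `one_add_runningLipP_step`, `one_add_runningLipP_le`).

Integrated from time `0` this would only give `exp (4 L t M)`, whereas the claim has `exp (t M)`.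
The factor `4 L` is removed because the constant may depend on the data, hence on the solution
itself up to a fixed time: Lipschitz solutions are unique (`feynmanKac_unique`), so on `[0, T']`
with `T' < T` all of them share one Lipschitz constant. With `4 L (T - T') = T'`, growth on `[T',
t]` contributes at most `exp (T' M) ≤ exp (t M)` from the `M`-dependent part of the rate.

Restarting at a random state raises a measurability problem: the definition supplies a
characteristic for each deterministic starting point, with no measurable dependence on that point.
`norm_integral_le_of_cells` replaces conditioning by a countable partition of the state space, so
that only countably many restarted characteristics occur. It needs their payoffs to be measurable
for the σ-algebra of the later increments. As nothing is assumed on `U` as a function of time, this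
starts with `IsFeynmanKac.intervalIntegrable_time` and continues with Riemann sums in
`aestronglyMeasurable_payoff`. -/

lemma intervalIntegrable_sub_of_mem {E : Type*} [NormedAddCommGroup E] {f : ℝ → E} {t r s : ℝ}
    (hf : IntervalIntegrable f volume 0 t) (hr : r ∈ Icc 0 t) (hs : s ∈ Icc 0 t) :
    IntervalIntegrable f volume r s :=
  hf.mono_set (uIcc_subset_uIcc (by rwa [uIcc_of_le (hr.1.trans hr.2)])
    (by rwa [uIcc_of_le (hr.1.trans hr.2)]))

lemma ContinuousOn.intervalIntegrable_zero {E : Type*} [NormedAddCommGroup E] {f : ℝ → E} {t : ℝ}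
    (ht : 0 ≤ t) (hf : ContinuousOn f (Icc 0 t)) : IntervalIntegrable f volume 0 t :=
  ContinuousOn.intervalIntegrable (by rwa [uIcc_of_le ht])

lemma continuousOn_integral_zero {E : Type*} [NormedAddCommGroup E] [NormedSpace ℝ E] {f : ℝ → E}
    {t : ℝ} (ht : 0 ≤ t) (hf : IntervalIntegrable f volume 0 t) :
    ContinuousOn (fun s => ∫ r in (0 : ℝ)..s, f r) (Icc 0 t) := by
  have := intervalIntegral.continuousOn_primitive_interval' hf (left_mem_uIcc)
  rwa [uIcc_of_le ht] at this

lemma le_mul_exp_of_le_add_integral {u : ℝ → ℝ} {a C t : ℝ} (hC : 0 ≤ C)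
    (hu : ContinuousOn u (Icc 0 t))
    (h : ∀ s ∈ Icc 0 t, u s ≤ a + C * ∫ r in (0 : ℝ)..s, u r) :
    ∀ s ∈ Icc 0 t, u s ≤ a * Real.exp (C * s) := by
  intro s hs
  have ht : 0 ≤ t := hs.1.trans hs.2
  -- Extending `u` by constants outside `[0, t]` makes its primitive differentiable everywhere, so
  -- the differential Grönwall inequality applies to the primitive; `u` itself need not be
  -- differentiable.
  set v : ℝ → ℝ := IccExtend ht ((Icc 0 t).domRestrict u) with hv
  have hvc : Continuous v := continuousOn_iff_continuous_domRestrict.1 hu |>.Icc_extend'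
  have hvu : ∀ s ∈ Icc 0 t, v s = u s := fun s hs => by rw [hv, IccExtend_of_mem ht _ hs]; rfl
  have hint : ∀ s ∈ Icc 0 t, ∫ r in (0 : ℝ)..s, v r = ∫ r in (0 : ℝ)..s, u r := by
    intro s hs
    refine intervalIntegral.integral_congr fun r hr => hvu r ?_
    rw [uIcc_of_le hs.1] at hr
    exact ⟨hr.1, hr.2.trans hs.2⟩
  have hd : ∀ x, HasDerivAt (fun s => ∫ r in (0 : ℝ)..s, v r) (v x) x := fun x =>
    intervalIntegral.integral_hasDerivAt_right (hvc.intervalIntegrable _ _)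
      hvc.stronglyMeasurable.stronglyMeasurableAtFilter hvc.continuousAt
  have key := le_gronwallBound_of_liminf_deriv_right_le
    (f := fun s => ∫ r in (0 : ℝ)..s, v r) (f' := v) (δ := 0) (K := C) (ε := a) (a := 0) (b := t)
    (fun x _ => (hd x).continuousAt.continuousWithinAt)
    (fun x _ r hr => by
      have := (hd x).hasDerivWithinAt (s := Ici x) |>.liminf_right_slope_le hr
      simpa [slope_def_field, div_eq_inv_mul] using this)
    (by simp)
    (fun x hx => by
      have := h x ⟨hx.1, hx.2.le⟩
      simp only [hint x ⟨hx.1, hx.2.le⟩, hvu x ⟨hx.1, hx.2.le⟩]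
      linarith) s hs
  have h1 := h s hs
  simp only [hint s hs, sub_zero] at key
  rcases hC.eq_or_lt with rfl | hC
  · simpa using h1
  · rw [gronwallBound_of_K_ne_0 hC.ne'] at key
    have h2 : C * ∫ r in (0 : ℝ)..s, u r ≤ a * (Real.exp (C * s) - 1) := by
      calc C * ∫ r in (0 : ℝ)..s, u r
          ≤ C * (0 * Real.exp (C * s) + a / C * (Real.exp (C * s) - 1)) := by gcongr
        _ = a * (Real.exp (C * s) - 1) := by field_simp; ring
    linarith

/-- The inhomogeneity `a` is not assumed monotone, since it will be the norm of a noise path. The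
primitive of `u` satisfies the constant-coefficient inequality with `∫₀ᵗ a`, so `a` enters the bound
only through its current value and its integral, both of which have computable means. -/
lemma le_add_of_le_add_integral {u a : ℝ → ℝ} {C t : ℝ} (hC : 0 ≤ C)
    (hu : ContinuousOn u (Icc 0 t)) (ha : ContinuousOn a (Icc 0 t)) (ha0 : ∀ s ∈ Icc 0 t, 0 ≤ a s)
    (h : ∀ s ∈ Icc 0 t, u s ≤ a s + C * ∫ r in (0 : ℝ)..s, u r) :
    ∀ s ∈ Icc 0 t, u s ≤ a s + C * Real.exp (C * t) * ∫ r in (0 : ℝ)..t, a r := by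
  intro s hs
  have ht : 0 ≤ t := hs.1.trans hs.2
  have hui := hu.intervalIntegrable_zero ht
  have hai := ha.intervalIntegrable_zero ht
  have hfc := continuousOn_integral_zero ht hui
  have hA : ∀ s ∈ Icc 0 t, ∫ r in (0 : ℝ)..s, a r ≤ ∫ r in (0 : ℝ)..t, a r := fun s hs =>
    intervalIntegral.integral_mono_interval le_rfl hs.1 hs.2
      ((ae_restrict_iff' measurableSet_Ioc).2 (.of_forall fun r hr => ha0 r ⟨hr.1.le, hr.2⟩)) hai
  have hA0 : 0 ≤ ∫ r in (0 : ℝ)..t, a r := intervalIntegral.integral_nonneg ht ha0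
  have key := le_mul_exp_of_le_add_integral hC hfc (a := ∫ r in (0 : ℝ)..t, a r) (fun s hs => by
    have h1 : ∫ r in (0 : ℝ)..s, u r ≤ ∫ r in (0 : ℝ)..s, (a r + C * ∫ q in (0 : ℝ)..r, u q) :=
      intervalIntegral.integral_mono_on hs.1
        (intervalIntegrable_sub_of_mem hui ⟨le_rfl, ht⟩ hs)
        ((intervalIntegrable_sub_of_mem hai ⟨le_rfl, ht⟩ hs).add
          ((intervalIntegrable_sub_of_mem (hfc.intervalIntegrable_zero ht) ⟨le_rfl, ht⟩
            hs).const_mul C))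
        (fun r hr => h r ⟨hr.1, hr.2.trans hs.2⟩)
    rw [intervalIntegral.integral_add (intervalIntegrable_sub_of_mem hai ⟨le_rfl, ht⟩ hs)
      ((intervalIntegrable_sub_of_mem (hfc.intervalIntegrable_zero ht) ⟨le_rfl, ht⟩
            hs).const_mul C), intervalIntegral.integral_const_mul] at h1
    linarith [hA s hs]) s hs
  have h2 : Real.exp (C * s) ≤ Real.exp (C * t) :=
    Real.exp_le_exp.2 (mul_le_mul_of_nonneg_left hs.2 hC)
  calc u s ≤ a s + C * ∫ r in (0 : ℝ)..s, u r := h s hs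
    _ ≤ a s + C * ((∫ r in (0 : ℝ)..t, a r) * Real.exp (C * t)) := by
        gcongr
        exact key.trans (by gcongr)
    _ = _ := by ring

/-! ### Stability of integral equations -/

/-- The comparison is required only along the two given curves, with an error `γ`. One statement
thus covers equal coefficients with different starting points, components with the noise subtracted,
and different coefficients as in the uniqueness proof. -/
lemma norm_sub_le_of_integral_eq {E : Type*} [NormedAddCommGroup E] [NormedSpace ℝ E]
    {X X' f f' : ℝ → E} {γ : ℝ → ℝ} {x x' : E} {a h : ℝ} (ha : 0 ≤ a)
    (hf : IntervalIntegrable f volume 0 h) (hf' : IntervalIntegrable f' volume 0 h)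
    (hγ : IntervalIntegrable γ volume 0 h) (hγ0 : ∀ s ∈ Icc 0 h, 0 ≤ γ s)
    (hX : ∀ s ∈ Icc 0 h, X s = x - ∫ r in (0 : ℝ)..s, f r)
    (hX' : ∀ s ∈ Icc 0 h, X' s = x' - ∫ r in (0 : ℝ)..s, f' r)
    (hff : ∀ s ∈ Icc 0 h, ‖f s - f' s‖ ≤ a * ‖X s - X' s‖ + γ s) :
    ∀ s ∈ Icc 0 h, ‖X s - X' s‖ ≤ (‖x - x'‖ + ∫ r in (0 : ℝ)..h, γ r) * Real.exp (a * s) := by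
  intro s hs
  have hh : 0 ≤ h := hs.1.trans hs.2
  have hcX : ContinuousOn X (Icc 0 h) :=
    (continuousOn_const.sub (continuousOn_integral_zero hh hf)).congr hX
  have hcX' : ContinuousOn X' (Icc 0 h) :=
    (continuousOn_const.sub (continuousOn_integral_zero hh hf')).congr hX'
  have hc : ContinuousOn (fun s => ‖X s - X' s‖) (Icc 0 h) := (hcX.sub hcX').norm
  refine le_mul_exp_of_le_add_integral ha hc (fun s hs => ?_) s hs
  have h0 : (0 : ℝ) ∈ Icc 0 h := ⟨le_rfl, hh⟩
  have hfs := intervalIntegrable_sub_of_mem hf h0 hs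
  have hfs' := intervalIntegrable_sub_of_mem hf' h0 hs
  have hγs := intervalIntegrable_sub_of_mem hγ h0 hs
  have hcs := intervalIntegrable_sub_of_mem (hc.intervalIntegrable_zero hh) h0 hs
  have e : X s - X' s = (x - x') - ∫ r in (0 : ℝ)..s, (f r - f' r) := by
    rw [hX s hs, hX' s hs, intervalIntegral.integral_sub hfs hfs']; abel
  have h1 : ‖∫ r in (0 : ℝ)..s, (f r - f' r)‖ ≤
      ∫ r in (0 : ℝ)..s, (a * ‖X r - X' r‖ + γ r) :=
    intervalIntegral.norm_integral_le_of_norm_le hs.1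
      (.of_forall fun r hr => hff r ⟨hr.1.le, hr.2.trans hs.2⟩) ((hcs.const_mul a).add hγs)
  rw [intervalIntegral.integral_add (hcs.const_mul a) hγs,
    intervalIntegral.integral_const_mul] at h1
  have h2 : ∫ r in (0 : ℝ)..s, γ r ≤ ∫ r in (0 : ℝ)..h, γ r :=
    intervalIntegral.integral_mono_interval le_rfl hs.1 hs.2
      ((ae_restrict_iff' measurableSet_Ioc).2 (.of_forall fun r hr => hγ0 r ⟨hr.1.le, hr.2⟩)) hγ
  calc ‖X s - X' s‖ ≤ ‖x - x'‖ + ‖∫ r in (0 : ℝ)..s, (f r - f' r)‖ := by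
        rw [e]; exact norm_sub_le _ _
    _ ≤ _ := by linarith

/-! ### Deterministic characteristics -/

/-- `(X, p)` solves, on `[0, t]` and for the fixed noise path `w`, the integral equations
`X_s = x - ∫₀ˢ B(t - r, X_r, p_r) dr`, `p_s = q - ∫₀ˢ b(p_r) dr + w_s`, with `X_s ∈ Ω`. -/
structure IsPath {E E' : Type*} [NormedAddCommGroup E] [NormedSpace ℝ E]
    [NormedAddCommGroup E'] [NormedSpace ℝ E'] (Ω : Set E) (b : E' → E')
    (B : ℝ → E → E' → E) (t : ℝ) (x : E) (q : E') (w : ℝ → E') (X : ℝ → E) (p : ℝ → E') :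
    Prop where
  mem : ∀ s ∈ Icc 0 t, X s ∈ Ω
  integrable_X : IntervalIntegrable (fun s => B (t - s) (X s) (p s)) volume 0 t
  integrable_p : IntervalIntegrable (fun s => b (p s)) volume 0 t
  eq_X : ∀ s ∈ Icc 0 t, X s = x - ∫ r in (0 : ℝ)..s, B (t - r) (X r) (p r)
  eq_p : ∀ s ∈ Icc 0 t, p s = q - (∫ r in (0 : ℝ)..s, b (p r)) + w s

/-- `B(τ, ·, ·)` is Lipschitz on `Ω × E'`, with constants `a` and `c` in the two variables, for
`τ ∈ [0, t]`. -/
def LipOn {E E' : Type*} [NormedAddCommGroup E] [NormedAddCommGroup E'] (Ω : Set E) (t a c : ℝ)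
    (B : ℝ → E → E' → E) : Prop :=
  ∀ τ ∈ Icc 0 t, ∀ x ∈ Ω, ∀ x' ∈ Ω, ∀ p p', ‖B τ x p - B τ x' p'‖ ≤ a * ‖x - x'‖ + c * ‖p - p'‖

/-- The quantity whose expectation is the Feynman–Kac representation. -/
noncomputable def payoff {E E' : Type*} [NormedAddCommGroup E] [NormedSpace ℝ E]
    (A : ℝ → E → E' → E) (U₀ : E → E' → E) (t : ℝ) (X : ℝ → E) (p : ℝ → E') : E :=
  (∫ s in (0 : ℝ)..t, A (t - s) (X s) (p s)) + U₀ (X t) (p t)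

section Path

variable {E E' : Type*} [NormedAddCommGroup E] [NormedSpace ℝ E]
  [NormedAddCommGroup E'] [NormedSpace ℝ E'] {Ω : Set E} {b : E' → E'}
  {A B B' : ℝ → E → E' → E} {U₀ : E → E' → E} {t t' a c β h : ℝ} {x x' : E} {q q' : E'}
  {w : ℝ → E'} {X X' : ℝ → E} {p p' : ℝ → E'}

lemma IsPath.continuousOn_X (H : IsPath Ω b B t x q w X p) (ht : 0 ≤ t) :
    ContinuousOn X (Icc 0 t) :=
  (continuousOn_const.sub (continuousOn_integral_zero ht H.integrable_X)).congr H.eq_X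

lemma IsPath.continuousOn_p (H : IsPath Ω b B t x q w X p) (ht : 0 ≤ t)
    (hw : ContinuousOn w (Icc 0 t)) : ContinuousOn p (Icc 0 t) :=
  ((continuousOn_const.sub (continuousOn_integral_zero ht H.integrable_p)).add hw).congr H.eq_p

/-- The coefficient is evaluated at the remaining time, so a restart at time `h` with horizon `t`
sees the same family `B`; the noise is replaced by its increments after `h`. -/
lemma IsPath.shift (ht : 0 ≤ t) (hh : 0 ≤ h) (H : IsPath Ω b B (t + h) x q w X p) :
    IsPath Ω b B t (X h) (p h) (fun r => w (h + r) - w h) (fun r => X (h + r))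
      (fun r => p (h + r)) := by
  have m : ∀ s ∈ Icc 0 t, h + s ∈ Icc 0 (t + h) := fun s hs =>
    ⟨add_nonneg hh hs.1, by linarith [hs.2]⟩
  have mh : h ∈ Icc 0 (t + h) := ⟨hh, by linarith⟩
  have e : ∀ s, B (t - s) (X (h + s)) (p (h + s)) =
      (fun r => B (t + h - r) (X r) (p r)) (h + s) := fun s => by
    simp only; congr 1; ring
  have iX : ∀ s ∈ Icc 0 t, ∫ r in (0 : ℝ)..s, B (t - r) (X (h + r)) (p (h + r)) =
      ∫ r in h..(h + s), B (t + h - r) (X r) (p r) := fun s _ => by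
    simp_rw [e]
    rw [intervalIntegral.integral_comp_add_left (fun r => B (t + h - r) (X r) (p r)), add_zero]
  have ip : ∀ s ∈ Icc 0 t, ∫ r in (0 : ℝ)..s, b (p (h + r)) =
      ∫ r in h..(h + s), b (p r) := fun s _ => by
    rw [intervalIntegral.integral_comp_add_left (fun r => b (p r)), add_zero]
  have h0 : (0 : ℝ) ∈ Icc 0 (t + h) := ⟨le_rfl, by linarith⟩
  refine ⟨fun s hs => H.mem _ (m s hs), ?_, ?_, fun s hs => ?_, fun s hs => ?_⟩
  · simp_rw [e]
    have := (intervalIntegrable_sub_of_mem H.integrable_X mh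
      (m t ⟨ht, le_rfl⟩)).comp_add_left h
    simpa using this
  · have := (intervalIntegrable_sub_of_mem H.integrable_p mh
      (m t ⟨ht, le_rfl⟩)).comp_add_left h
    simpa using this
  · rw [iX s hs, H.eq_X _ (m s hs), H.eq_X h mh, sub_sub,
      intervalIntegral.integral_add_adjacent_intervals
        (intervalIntegrable_sub_of_mem H.integrable_X h0 mh)
        (intervalIntegrable_sub_of_mem H.integrable_X mh (m s hs))]
  · rw [ip s hs, H.eq_p _ (m s hs), H.eq_p h mh,
      ← intervalIntegral.integral_add_adjacent_intervals
        (intervalIntegrable_sub_of_mem H.integrable_p h0 mh)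
        (intervalIntegrable_sub_of_mem H.integrable_p mh (m s hs))]
    abel

/-- Subtracting the common noise leaves two ordinary integral equations for `p`, decoupled from `X`.
This is why the fields `B` and `B'` may differ. -/
lemma IsPath.norm_p_sub_le (hβ : 0 ≤ β) (hb : ∀ p p', ‖b p - b p'‖ ≤ β * ‖p - p'‖)
    (H : IsPath Ω b B t x q w X p) (H' : IsPath Ω b B' t x' q' w X' p') :
    ∀ s ∈ Icc 0 t, ‖p s - p' s‖ ≤ ‖q - q'‖ * Real.exp (β * s) := by
  intro s hs
  have := norm_sub_le_of_integral_eq (X := fun s => p s - w s) (X' := fun s => p' s - w s)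
    (x := q) (x' := q') (γ := fun _ => 0) hβ H.integrable_p H'.integrable_p (by simp) (by simp)
    (fun s hs => by simp [H.eq_p s hs]) (fun s hs => by simp [H'.eq_p s hs])
    (fun s _ => by simpa using hb (p s) (p' s)) s hs
  simpa using this

lemma IsPath.norm_X_sub_le (ha : 0 ≤ a) (hc : 0 ≤ c) (hβ : 0 ≤ β)
    (hb : ∀ p p', ‖b p - b p'‖ ≤ β * ‖p - p'‖) (hB : LipOn Ω t a c B) (hh : h ∈ Icc 0 t)
    (H : IsPath Ω b B t x q w X p) (H' : IsPath Ω b B t x' q' w X' p') :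
    ∀ s ∈ Icc 0 h, ‖X s - X' s‖ ≤
      (‖x - x'‖ + h * (c * (‖q - q'‖ * Real.exp (β * h)))) * Real.exp (a * h) := by
  intro s hs
  have h0 : (0 : ℝ) ∈ Icc 0 t := ⟨le_rfl, hh.1.trans hh.2⟩
  have m : ∀ s ∈ Icc 0 h, s ∈ Icc 0 t := fun s hs => ⟨hs.1, hs.2.trans hh.2⟩
  have := norm_sub_le_of_integral_eq (X := X) (X' := X') (h := h)
    (γ := fun _ => c * (‖q - q'‖ * Real.exp (β * h))) ha
    (intervalIntegrable_sub_of_mem H.integrable_X h0 hh)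
    (intervalIntegrable_sub_of_mem H'.integrable_X h0 hh)
    (by simp) (fun s hs => by positivity)
    (fun s hs => H.eq_X s (m s hs)) (fun s hs => H'.eq_X s (m s hs))
    (fun s hs => (hB (t - s) ⟨by linarith [(m s hs).2], by linarith [hs.1]⟩ _ (H.mem s (m s hs))
      _ (H'.mem s (m s hs)) _ _).trans (by
        gcongr
        refine (H.norm_p_sub_le hβ hb H' s (m s hs)).trans ?_
        gcongr
        exact hs.2)) s hs
  refine this.trans ?_
  have h0 := hh.1
  simp only [intervalIntegral.integral_const, smul_eq_mul, sub_zero]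
  gcongr
  exact hs.2

/-- Difference of the running payoffs along two characteristics driven by the same noise. -/
lemma IsPath.norm_integral_sub_le (ha : 0 ≤ a) (hc : 0 ≤ c) (hβ : 0 ≤ β)
    (hb : ∀ p p', ‖b p - b p'‖ ≤ β * ‖p - p'‖) (hB : LipOn Ω t a c B) (hA : LipOn Ω t a c A)
    (hh : h ∈ Icc 0 t)
    (H : IsPath Ω b B t x q w X p) (H' : IsPath Ω b B t x' q' w X' p')
    (hi : IntervalIntegrable (fun s => A (t - s) (X s) (p s)) volume 0 t)
    (hi' : IntervalIntegrable (fun s => A (t - s) (X' s) (p' s)) volume 0 t) :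
    ‖(∫ s in (0 : ℝ)..h, A (t - s) (X s) (p s)) - ∫ s in (0 : ℝ)..h, A (t - s) (X' s) (p' s)‖ ≤
      h * (a * ((‖x - x'‖ + h * (c * (‖q - q'‖ * Real.exp (β * h)))) * Real.exp (a * h)) +
        c * (‖q - q'‖ * Real.exp (β * h))) := by
  have h0 : (0 : ℝ) ∈ Icc 0 t := ⟨le_rfl, hh.1.trans hh.2⟩
  have m : ∀ s ∈ Icc 0 h, s ∈ Icc 0 t := fun s hs => ⟨hs.1, hs.2.trans hh.2⟩
  rw [← intervalIntegral.integral_sub (intervalIntegrable_sub_of_mem hi h0 hh)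
    (intervalIntegrable_sub_of_mem hi' h0 hh)]
  refine (intervalIntegral.norm_integral_le_of_norm_le_const
    (C := a * ((‖x - x'‖ + h * (c * (‖q - q'‖ * Real.exp (β * h)))) * Real.exp (a * h)) +
      c * (‖q - q'‖ * Real.exp (β * h))) fun s hs => ?_).trans (le_of_eq ?_)
  · rw [uIoc_of_le hh.1] at hs
    have hs' : s ∈ Icc 0 h := ⟨hs.1.le, hs.2⟩
    refine (hA (t - s) ⟨by linarith [(m s hs').2], by linarith [hs.1]⟩ _ (H.mem s (m s hs'))
      _ (H'.mem s (m s hs')) _ _).trans ?_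
    gcongr
    · exact H.norm_X_sub_le ha hc hβ hb hB hh H' s hs'
    · refine (H.norm_p_sub_le hβ hb H' s (m s hs')).trans ?_
      gcongr
      exact hs.2
  · rw [sub_zero, abs_of_nonneg hh.1, mul_comm]

/-- Payoffs depend on the starting point in a Lipschitz way. -/
lemma exists_norm_payoff_sub_le (ht : 0 ≤ t) (ha : 0 ≤ a) (hc : 0 ≤ c) (hβ : 0 ≤ β)
    (hb : ∀ p p', ‖b p - b p'‖ ≤ β * ‖p - p'‖) (hB : LipOn Ω t a c B) (hA : LipOn Ω t a c A)
    {k : ℝ} (hk : 0 ≤ k)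
    (hU₀ : ∀ x ∈ Ω, ∀ x' ∈ Ω, ∀ p p', ‖U₀ x p - U₀ x' p'‖ ≤ k * (‖x - x'‖ + ‖p - p'‖)) :
    ∃ C, 0 ≤ C ∧ ∀ (x x' : E) (q q' : E') (w : ℝ → E') (X X' : ℝ → E) (p p' : ℝ → E'),
      IsPath Ω b B t x q w X p → IsPath Ω b B t x' q' w X' p' →
      IntervalIntegrable (fun s => A (t - s) (X s) (p s)) volume 0 t →
      IntervalIntegrable (fun s => A (t - s) (X' s) (p' s)) volume 0 t →
      ‖payoff A U₀ t X p - payoff A U₀ t X' p'‖ ≤ C * (‖x - x'‖ + ‖q - q'‖) := by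
  refine ⟨t * (a * ((1 + t * (c * Real.exp (β * t))) * Real.exp (a * t)) + c * Real.exp (β * t)) +
    k * ((1 + t * (c * Real.exp (β * t))) * Real.exp (a * t) + Real.exp (β * t)), by positivity,
    fun x x' q q' w X X' p p' H H' hi hi' => ?_⟩
  have tt : t ∈ Icc 0 t := ⟨ht, le_rfl⟩
  have h1 := H.norm_integral_sub_le ha hc hβ hb hB hA tt H' hi hi'
  have h2 := H.norm_X_sub_le ha hc hβ hb hB tt H' t tt
  have h3 := H.norm_p_sub_le hβ hb H' t tt
  have h4 := hU₀ _ (H.mem t tt) _ (H'.mem t tt) (p t) (p' t)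
  set D := ‖x - x'‖ + ‖q - q'‖
  have hx : ‖x - x'‖ ≤ D := le_add_of_nonneg_right (norm_nonneg _)
  have hq : ‖q - q'‖ ≤ D := le_add_of_nonneg_left (norm_nonneg _)
  have hD : 0 ≤ D := by positivity
  have h5 : (‖x - x'‖ + t * (c * (‖q - q'‖ * Real.exp (β * t)))) * Real.exp (a * t) ≤
      (D + t * (c * (D * Real.exp (β * t)))) * Real.exp (a * t) := by gcongr
  have h6 : ‖q - q'‖ * Real.exp (β * t) ≤ D * Real.exp (β * t) := by gcongr
  unfold payoff
  rw [add_sub_add_comm]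
  calc _ ≤ _ := norm_add_le _ _
    _ ≤ t * (a * ((D + t * (c * (D * Real.exp (β * t)))) * Real.exp (a * t)) +
          c * (D * Real.exp (β * t))) +
        k * ((D + t * (c * (D * Real.exp (β * t)))) * Real.exp (a * t) +
          D * Real.exp (β * t)) := by
        refine add_le_add (h1.trans ?_) (h4.trans ?_)
        · gcongr
        · gcongr
          · exact h2.trans h5
          · exact h3.trans h6
    _ = _ := by ring

/-- A priori bound on the second component of a characteristic in terms of the noise. -/
lemma IsPath.one_add_norm_p_le (hβ : 0 ≤ β) (hb : ∀ p p', ‖b p - b p'‖ ≤ β * ‖p - p'‖)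
    (ht : 0 ≤ t) (hw : ContinuousOn w (Icc 0 t)) (H : IsPath Ω b B t x q w X p) :
    ∀ s ∈ Icc 0 t, 1 + ‖p s‖ ≤ (1 + ‖q‖ + ‖w s‖) + (β + ‖b 0‖) * Real.exp ((β + ‖b 0‖) * t) *
      ∫ r in (0 : ℝ)..t, (1 + ‖q‖ + ‖w r‖) := by
  have hp := H.continuousOn_p ht hw
  refine le_add_of_le_add_integral (by positivity) (continuousOn_const.add hp.norm)
    (continuousOn_const.add hw.norm) (fun _ _ => by positivity) fun s hs => ?_
  have hpi := intervalIntegrable_sub_of_mem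
    ((continuousOn_const.add hp.norm).intervalIntegrable_zero (f := fun s => 1 + ‖p s‖) ht)
    ⟨le_rfl, ht⟩ hs
  have h1 : ‖∫ r in (0 : ℝ)..s, b (p r)‖ ≤ ∫ r in (0 : ℝ)..s, (β + ‖b 0‖) * (1 + ‖p r‖) := by
    refine intervalIntegral.norm_integral_le_of_norm_le hs.1 (.of_forall fun r _ => ?_)
      (hpi.const_mul _)
    have h2 := hb (p r) 0
    have h3 : ‖b (p r)‖ ≤ ‖b (p r) - b 0‖ + ‖b 0‖ := by
      simpa using norm_add_le (b (p r) - b 0) (b 0)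
    rw [sub_zero] at h2
    nlinarith [norm_nonneg (p r), norm_nonneg (b 0)]
  rw [intervalIntegral.integral_const_mul] at h1
  have h4 : ‖p s‖ ≤ ‖q‖ + ‖∫ r in (0 : ℝ)..s, b (p r)‖ + ‖w s‖ := by
    rw [H.eq_p s hs]
    exact (norm_add_le _ _).trans (by gcongr; exact norm_sub_le _ _)
  linarith

end Path

lemma IsCharacteristic.isPath {d m : ℕ} {S : Type*} [MeasurableSpace S] {P : Measure S}
    {W : ℝ≥0 → S → EuclideanSpace ℝ (Fin m)} {Ω : Set (EuclideanSpace ℝ (Fin d))} {σ : ℝ}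
    {b : EuclideanSpace ℝ (Fin m) → EuclideanSpace ℝ (Fin m)}
    {B : ℝ → EuclideanSpace ℝ (Fin d) → EuclideanSpace ℝ (Fin m) → EuclideanSpace ℝ (Fin d)}
    {t : ℝ} {x : EuclideanSpace ℝ (Fin d)} {q : EuclideanSpace ℝ (Fin m)}
    {X : ℝ → S → EuclideanSpace ℝ (Fin d)} {p : ℝ → S → EuclideanSpace ℝ (Fin m)}
    (H : IsCharacteristic P W Ω σ b B t x q X p) :
    ∀ᵐ ω ∂P, IsPath Ω b B t x q (fun s => Real.sqrt (2 * σ) • W s.toNNReal ω)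
      (fun s => X s ω) (fun s => p s ω) := by
  filter_upwards [H.mem, H.integrable_X, H.integrable_p, H.eq_X, H.eq_p] with ω h1 h2 h3 h4 h5
  exact ⟨h1, h2, h3, h4, h5⟩

/-! ### Measurability in time -/

open Filter Topology in
/-- A function that is, to the left of every point and up to every error, close to a measurable
function is measurable. -/
lemma aestronglyMeasurable_of_left_approx {E : Type*} [NormedAddCommGroup E] [MeasurableSpace E]
    [BorelSpace E] [SecondCountableTopology E] {γ : ℝ → E} {t : ℝ}
    (h : ∀ ε > 0, ∀ t' ∈ Ioc 0 t, ∃ δ > 0, ∃ φ : ℝ → E,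
      AEStronglyMeasurable φ (volume.restrict (Ioo (t' - δ) t')) ∧
        ∀ τ ∈ Ioo (t' - δ) t', ‖γ τ - φ τ‖ ≤ ε) :
    AEStronglyMeasurable γ (volume.restrict (Ioc 0 t)) := by
  rcases le_or_gt t 0 with ht | ht
  · rw [Ioc_eq_empty (not_lt.2 ht), Measure.restrict_empty]
    exact aestronglyMeasurable_zero_measure _
  have key : ∀ ε > 0, ∃ ψ : ℝ → E, Measurable ψ ∧
      ∀ᵐ τ ∂(volume.restrict (Ioc 0 t)), ‖γ τ - ψ τ‖ ≤ ε := by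
    intro ε hε
    choose! δ hδ φ hφ hγ using h ε hε
    let I : ℝ → Set ℝ := fun t' => Ioo (t' - δ t') t'
    obtain ⟨s, hsub, hsc, hsU⟩ : ∃ s : Set ℝ, s ⊆ Ioc 0 t ∧ s.Countable ∧
        ⋃ i ∈ s, I i = ⋃ i ∈ Ioc 0 t, I i := by
      obtain ⟨s, hs, h1, h2⟩ := TopologicalSpace.isOpen_biUnion_countable (Ioc 0 t) I
        (fun _ _ => isOpen_Ioo)
      exact ⟨s, hs, h1, h2⟩
    -- The point `t` is inserted only to have a nonempty set to enumerate.
    obtain ⟨f, hf⟩ := (hsc.insert t).exists_eq_range (insert_nonempty _ _)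
    have hfm : ∀ n, f n ∈ Ioc 0 t := fun n => by
      have : f n ∈ insert t s := hf ▸ mem_range_self n
      rcases this with h | h
      · rw [h]; exact ⟨ht, le_rfl⟩
      · exact hsub h
    -- An uncovered point lies outside the left interval of every other point, so the left intervals
    -- of the uncovered points are pairwise disjoint and there are countably many of them. The
    -- reflection `x ↦ -x` turns them into right intervals.
    have hR : (Ioc 0 t \ ⋃ i ∈ Ioc 0 t, I i).Countable := by
      have : (fun x : ℝ => -x) ⁻¹' (Ioc 0 t \ ⋃ i ∈ Ioc 0 t, I i) |>.Countable := by
        refine PairwiseDisjoint.countable_of_Ioo (y := fun x => x + δ (-x)) ?_ ?_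
        · have aux : ∀ x y : ℝ, x < y → -x ∈ Ioc 0 t \ ⋃ i ∈ Ioc 0 t, I i →
              -y ∈ Ioc 0 t \ ⋃ i ∈ Ioc 0 t, I i →
              Disjoint (Ioo x (x + δ (-x))) (Ioo y (y + δ (-y))) := by
            intro x y hxy hx hy
            have h1 := hy.2
            simp only [mem_iUnion, not_exists, I, mem_Ioo, not_and, not_lt] at h1
            have h2 := h1 (-x) hx.1
            rw [Set.disjoint_left]
            intro z hz hz'
            by_contra
            have : x + δ (-x) ≤ y := by
              by_contra hlt
              have := h2 (by linarith)
              linarith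
            linarith [hz.2, hz'.1]
          intro x hx y hy hxy
          rcases lt_or_gt_of_ne hxy with h | h
          · exact aux x y h hx hy
          · exact (aux y x h hy hx).symm
        · intro x hx
          have := hδ (-x) hx.1
          linarith
      have h2 := this.image (fun x => -x)
      refine h2.mono ?_
      intro x hx
      exact (mem_image _ _ _).2 ⟨-x, by simpa only [mem_preimage, neg_neg] using hx, neg_neg x⟩
    have hI : ∀ n, AEStronglyMeasurable (φ (f n)) (volume.restrict (I (f n))) :=
      fun n => hφ _ (hfm n)
    have hcov : ∀ τ ∈ ⋃ i ∈ Ioc 0 t, I i, ∃ n, τ ∈ disjointed (fun n => I (f n)) n := by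
      intro τ hτ
      rw [← mem_iUnion, iUnion_disjointed]
      rw [← hsU] at hτ
      simp only [mem_iUnion] at hτ ⊢
      obtain ⟨i, hi, hτ⟩ := hτ
      have : i ∈ range f := hf ▸ mem_insert_of_mem _ hi
      obtain ⟨n, rfl⟩ := this
      exact ⟨n, hτ⟩
    obtain ⟨ψ, hψm, hψ⟩ := exists_measurable_piecewise (disjointed fun n => I (f n))
      (fun n => MeasurableSet.disjointed (fun n => measurableSet_Ioo) n)
      (fun n => (hI n).mk) (fun n => (hI n).measurable_mk)
      (fun i j hij x hx => (Set.disjoint_left.1 (disjoint_disjointed _ hij) hx.1 hx.2).elim)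
    refine ⟨ψ, hψm, ?_⟩
    have h1 : ∀ᵐ τ ∂(volume.restrict (Ioc 0 t)), τ ∈ ⋃ i ∈ Ioc 0 t, I i := by
      rw [ae_restrict_iff' measurableSet_Ioc]
      filter_upwards [hR.ae_notMem volume] with τ h1 h2
      by_contra h3
      exact h1 ⟨h2, h3⟩
    have h2 : ∀ᵐ τ ∂(volume.restrict (Ioc 0 t)), ∀ n, τ ∈ I (f n) → φ (f n) τ = (hI n).mk _ τ :=
      ae_restrict_of_ae (ae_all_iff.2 fun n =>
        (ae_restrict_iff' measurableSet_Ioo).1 (hI n).ae_eq_mk)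
    filter_upwards [h1, h2] with τ h3 h4
    obtain ⟨n, hn⟩ := hcov τ h3
    have hn' : τ ∈ I (f n) := disjointed_subset (fun n => I (f n)) n hn
    rw [hψ n hn, ← h4 n hn']
    exact hγ _ (hfm n) τ hn'
  choose ψ hψm hψ using fun n : ℕ => key (1 / (n + 1 : ℝ)) (by positivity)
  refine aestronglyMeasurable_of_tendsto_ae atTop (f := ψ)
    (fun n => (hψm n).stronglyMeasurable.aestronglyMeasurable) ?_
  filter_upwards [ae_all_iff.2 hψ] with τ hτ
  rw [tendsto_iff_norm_sub_tendsto_zero]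
  refine squeeze_zero (fun _ => norm_nonneg _) (fun n => ?_) tendsto_one_div_add_atTop_nhds_zero_nat
  rw [norm_sub_rev]
  exact hτ n

/-! ### Almost sure limits and compositions for a sub-σ-algebra -/

lemma stronglyMeasurable_limUnder_atTop {S E : Type*} {𝓜 : MeasurableSpace S} [NormedAddCommGroup E]
    [CompleteSpace E] {f : ℕ → S → E} (hf : ∀ n, StronglyMeasurable (f n)) :
    StronglyMeasurable (fun ω => Filter.limUnder Filter.atTop fun n => f n ω) :=
  StronglyMeasurable.limUnder hf

lemma aestronglyMeasurable_sum_of_le {S E : Type*} {𝓜 m0 : MeasurableSpace S}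
    {P : Measure S} [NormedAddCommGroup E] {f : ℕ → S → E} (s : Finset ℕ)
    (hf : ∀ n ∈ s, AEStronglyMeasurable[𝓜] (f n) P) :
    AEStronglyMeasurable[𝓜] (fun ω => ∑ n ∈ s, f n ω) P := by
  induction s using Finset.cons_induction with
  | empty => simpa using ⟨fun _ => 0, @stronglyMeasurable_const _ _ 𝓜 _ _, by rfl⟩
  | cons i s hi ih =>
    simp only [Finset.sum_cons]
    exact (hf i (Finset.mem_cons_self i s)).add
      (ih fun n hn => hf n (Finset.mem_cons_of_mem hn))

open Filter Topology in
-- The measure lives on the larger σ-algebra, so null sets need not belong to `𝓜`. The limit is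
-- taken of the `𝓜`-measurable representatives, and `limUnder` is measurable even where they
-- diverge.
lemma aestronglyMeasurable_of_tendsto_ae_of_le {S E : Type*} {𝓜 m0 : MeasurableSpace S}
    {P : Measure S} [NormedAddCommGroup E] [CompleteSpace E] {f : ℕ → S → E} {g : S → E}
    (hf : ∀ n, AEStronglyMeasurable[𝓜] (f n) P)
    (h : ∀ᵐ ω ∂P, Tendsto (fun n => f n ω) atTop (𝓝 (g ω))) :
    AEStronglyMeasurable[𝓜] g P := by
  choose f' hf' hff using hf
  refine ⟨fun ω => limUnder atTop fun n => f' n ω, stronglyMeasurable_limUnder_atTop hf', ?_⟩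
  filter_upwards [h, ae_all_iff.2 hff] with ω h1 h2
  simp only [h2] at h1
  exact h1.limUnder_eq.symm

/-- The `𝓜`-measurable representative of `X` may leave `Ω` on a null set, so `f` is extended by zero
outside `Ω` before composing. -/
lemma ContinuousOn.comp_aestronglyMeasurable_of_le {S E E' F : Type*} {𝓜 m0 : MeasurableSpace S}
    {P : Measure S} [NormedAddCommGroup E] [SecondCountableTopology E]
    [NormedAddCommGroup E'] [SecondCountableTopology E'] [NormedAddCommGroup F]
    [SecondCountableTopology F]
    {Ω : Set E} (hΩ : IsOpen Ω) {f : E → E' → F}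
    (hf : ContinuousOn (fun z : E × E' => f z.1 z.2) (Ω ×ˢ univ)) {X : S → E} {p : S → E'}
    (hX : AEStronglyMeasurable[𝓜] X P) (hp : AEStronglyMeasurable[𝓜] p P)
    (hm : ∀ᵐ ω ∂P, X ω ∈ Ω) : AEStronglyMeasurable[𝓜] (fun ω => f (X ω) (p ω)) P := by
  classical
  borelize E E' F
  obtain ⟨X', hX', hXX⟩ := hX
  obtain ⟨p', hp', hpp⟩ := hp
  have hO : IsOpen (Ω ×ˢ (univ : Set E')) := hΩ.prod isOpen_univ
  have hg : Measurable ((Ω ×ˢ (univ : Set E')).piecewise (fun z : E × E' => f z.1 z.2)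
      (fun _ => 0)) := hf.measurable_piecewise continuousOn_const hO.measurableSet
  have h1 : Measurable[𝓜] fun ω => (X' ω, p' ω) := hX'.measurable.prodMk hp'.measurable
  refine ⟨_, (hg.comp h1).stronglyMeasurable, ?_⟩
  filter_upwards [hXX, hpp, hm] with ω h1 h2 h3
  rw [h1] at h3
  rw [Function.comp_apply, piecewise_eq_of_mem _ _ _ (mk_mem_prod h3 (mem_univ _)), h1, h2]

/-! ### Riemann sums -/

open Filter Topology in
-- Only the first argument of `f` is frozen at grid points, the second is still integrated: the
-- coefficients are continuous in the state but merely integrable in time, so ordinary Riemann sums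
-- could fail.
lemma tendsto_sum_integral_of_close {E : Type*} [NormedAddCommGroup E] [NormedSpace ℝ E]
    {g : ℝ → E} {f : ℝ → ℝ → E} {t : ℝ} (ht : 0 ≤ t) (hg : IntervalIntegrable g volume 0 t)
    (hf : ∀ r ∈ Icc 0 t, IntervalIntegrable (f r) volume 0 t)
    (h : ∀ ε > 0, ∃ δ > 0, ∀ r ∈ Icc 0 t, ∀ s ∈ Icc 0 t, |s - r| < δ → ‖f r s - g s‖ ≤ ε) :
    Tendsto (fun n : ℕ => ∑ j ∈ Finset.range (n + 1),
      ∫ s in (t * (j / (n + 1 : ℝ)))..(t * ((j + 1 : ℕ) / (n + 1 : ℝ))),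
        f (t * (j / (n + 1 : ℝ))) s) atTop (𝓝 (∫ s in (0 : ℝ)..t, g s)) := by
  rw [Metric.tendsto_atTop]
  intro ε hε
  -- The denominator `2 * (t + 1)` keeps the total error strictly below `ε` and also covers `t = 0`.
  obtain ⟨δ, hδ, H⟩ := h (ε / (2 * (t + 1))) (by positivity)
  obtain ⟨N, hN⟩ := exists_nat_gt (t / δ)
  refine ⟨N, fun n hn => ?_⟩
  have hn0 : (0 : ℝ) < n + 1 := by positivity
  set τ : ℕ → ℝ := fun j => t * (j / (n + 1 : ℝ)) with hτ
  have hτm : ∀ j ≤ n + 1, τ j ∈ Icc 0 t := fun j hj => by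
    have h1 : (j : ℝ) / (n + 1) ≤ 1 := by
      rw [div_le_one hn0]; exact_mod_cast hj
    exact ⟨by positivity, mul_le_of_le_one_right ht h1⟩
  have hstep : ∀ j, τ (j + 1) - τ j = t / (n + 1) := fun j => by
    simp only [hτ]; push_cast; field_simp; ring
  have hsd : t / (n + 1) < δ := by
    rw [div_lt_iff₀ hn0]
    rw [div_lt_iff₀ hδ] at hN
    have : (N : ℝ) ≤ n := by exact_mod_cast hn
    nlinarith
  have hmono : ∀ j, τ j ≤ τ (j + 1) := fun j => by
    have := hstep j
    have : 0 ≤ t / (n + 1) := by positivity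
    linarith
  have hsum : ∑ j ∈ Finset.range (n + 1), ∫ s in (τ j)..(τ (j + 1)), g s =
      ∫ s in (0 : ℝ)..t, g s := by
    rw [intervalIntegral.sum_integral_adjacent_intervals fun j hj =>
      intervalIntegrable_sub_of_mem hg (hτm j (by omega)) (hτm (j + 1) (by omega))]
    congr 1
    · simp [hτ]
    · simp only [hτ]; push_cast; field_simp
  have hle : dist (∑ j ∈ Finset.range (n + 1), ∫ s in (τ j)..(τ (j + 1)), f (τ j) s)
      (∫ s in (0 : ℝ)..t, g s) ≤
      ∑ j ∈ Finset.range (n + 1), ε / (2 * (t + 1)) * (t / (n + 1)) := by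
    rw [← hsum, dist_eq_norm, ← Finset.sum_sub_distrib]
    refine norm_sum_le_of_le _ fun j hj => ?_
    have hj' := Finset.mem_range.1 hj
    have m1 := hτm j (by omega)
    have m2 := hτm (j + 1) (by omega)
    rw [← intervalIntegral.integral_sub (intervalIntegrable_sub_of_mem (hf _ m1) m1 m2)
      (intervalIntegrable_sub_of_mem hg m1 m2)]
    refine (intervalIntegral.norm_integral_le_of_norm_le_const
      (C := ε / (2 * (t + 1))) fun s hs => ?_).trans (le_of_eq ?_)
    · rw [uIoc_of_le (hmono j)] at hs
      refine H _ m1 s ⟨m1.1.trans hs.1.le, hs.2.trans m2.2⟩ ?_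
      rw [abs_lt]
      have := hstep j
      constructor <;> linarith [hs.1, hs.2]
    · rw [hstep, abs_of_nonneg (by positivity)]
  refine lt_of_le_of_lt hle ?_
  rw [Finset.sum_const, Finset.card_range, nsmul_eq_mul]
  push_cast
  have : (n + 1 : ℝ) * (ε / (2 * (t + 1)) * (t / (n + 1))) = ε * (t / (2 * (t + 1))) := by
    field_simp
  rw [this]
  have h2 : t / (2 * (t + 1)) < 1 := by
    rw [div_lt_one (by positivity)]; linarith
  nlinarith

open Filter Topology in
-- Measurability for the σ-algebra of the noise is needed so that independence of Brownian
-- increments can act on payoffs. With the state frozen at grid times, each term of the sum is a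
-- Lipschitz function of finitely many adapted variables; continuity of the paths gives convergence.
lemma aestronglyMeasurable_payoff {S E E' : Type*} {𝓜 m0 : MeasurableSpace S} {P : Measure S}
    [NormedAddCommGroup E] [NormedSpace ℝ E] [CompleteSpace E] [SecondCountableTopology E]
    [NormedAddCommGroup E'] [SecondCountableTopology E']
    {Ω : Set E} (hΩ : IsOpen Ω) {A : ℝ → E → E' → E} {U₀ : E → E' → E} {t a c : ℝ} (ht : 0 ≤ t)
    (ha : 0 ≤ a) (hc : 0 ≤ c)
    (hA : LipOn Ω t a c A)
    (hAi : ∀ x ∈ Ω, ∀ q, IntervalIntegrable (fun s => A (t - s) x q) volume 0 t)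
    (hU₀ : ContinuousOn (fun z : E × E' => U₀ z.1 z.2) (Ω ×ˢ univ)) {X : ℝ → S → E}
    {p : ℝ → S → E'} (hX : ∀ s ∈ Icc 0 t, AEStronglyMeasurable[𝓜] (X s) P)
    (hp : ∀ s ∈ Icc 0 t, AEStronglyMeasurable[𝓜] (p s) P)
    (hm : ∀ᵐ ω ∂P, ∀ s ∈ Icc 0 t, X s ω ∈ Ω)
    (hXc : ∀ᵐ ω ∂P, ContinuousOn (fun s => X s ω) (Icc 0 t))
    (hpc : ∀ᵐ ω ∂P, ContinuousOn (fun s => p s ω) (Icc 0 t))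
    (hi : ∀ᵐ ω ∂P, IntervalIntegrable (fun s => A (t - s) (X s ω) (p s ω)) volume 0 t) :
    AEStronglyMeasurable[𝓜] (fun ω => payoff A U₀ t (fun s => X s ω) (fun s => p s ω)) P := by
  have tt : t ∈ Icc 0 t := ⟨ht, le_rfl⟩
  have h2 : AEStronglyMeasurable[𝓜] (fun ω => U₀ (X t ω) (p t ω)) P :=
    ContinuousOn.comp_aestronglyMeasurable_of_le hΩ hU₀ (hX t tt) (hp t tt)
      (hm.mono fun ω h => h t tt)
  suffices h1 : AEStronglyMeasurable[𝓜]
      (fun ω => ∫ s in (0 : ℝ)..t, A (t - s) (X s ω) (p s ω)) P from h1.add h2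
  refine aestronglyMeasurable_of_tendsto_ae_of_le
    (f := fun n ω => ∑ j ∈ Finset.range (n + 1),
      ∫ s in (t * (j / (n + 1 : ℝ)))..(t * ((j + 1 : ℕ) / (n + 1 : ℝ))),
        A (t - s) (X (t * (j / (n + 1 : ℝ))) ω) (p (t * (j / (n + 1 : ℝ))) ω)) ?_ ?_
  · intro n
    have hn0 : (0 : ℝ) < n + 1 := by positivity
    have hτm : ∀ j : ℕ, j ≤ n + 1 → t * (j / (n + 1 : ℝ)) ∈ Icc 0 t := fun j hj => by
      have h1 : (j : ℝ) / (n + 1) ≤ 1 := by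
        rw [div_le_one hn0]; exact_mod_cast hj
      exact ⟨by positivity, mul_le_of_le_one_right ht h1⟩
    refine aestronglyMeasurable_sum_of_le _ fun j hj => ?_
    have hj' := Finset.mem_range.1 hj
    have m1 := hτm j (by omega)
    have m2 := hτm (j + 1) (by omega)
    have m3 : t * (j / (n + 1 : ℝ)) ≤ t * ((j + 1 : ℕ) / (n + 1 : ℝ)) := by
      push_cast; gcongr; linarith
    refine ContinuousOn.comp_aestronglyMeasurable_of_le hΩ (f := fun x q =>
      ∫ s in (t * (j / (n + 1 : ℝ)))..(t * ((j + 1 : ℕ) / (n + 1 : ℝ))), A (t - s) x q) ?_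
      (hX _ m1) (hp _ m1) (hm.mono fun ω h => h _ m1)
    have : LipschitzOnWith (Real.toNNReal ((a + c) *
        |t * ((j + 1 : ℕ) / (n + 1 : ℝ)) - t * (j / (n + 1 : ℝ))|))
        (fun z : E × E' => ∫ s in (t * (j / (n + 1 : ℝ)))..(t * ((j + 1 : ℕ) / (n + 1 : ℝ))),
          A (t - s) z.1 z.2) (Ω ×ˢ univ) := by
      refine LipschitzOnWith.of_dist_le_mul fun z hz z' hz' => ?_
      rw [dist_eq_norm, ← intervalIntegral.integral_sub
        (intervalIntegrable_sub_of_mem (hAi _ hz.1 _) m1 m2)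
        (intervalIntegrable_sub_of_mem (hAi _ hz'.1 _) m1 m2), Real.coe_toNNReal _ (by positivity)]
      refine (intervalIntegral.norm_integral_le_of_norm_le_const
        (C := (a + c) * dist z z') fun s hs => ?_).trans (le_of_eq (by ring))
      rw [uIoc_of_le m3] at hs
      refine (hA (t - s) ⟨by linarith [hs.2, m2.2], by linarith [hs.1, m1.1]⟩ _ hz.1 _ hz'.1
        _ _).trans ?_
      rw [add_mul, Prod.dist_eq, dist_eq_norm, dist_eq_norm]
      gcongr
      · exact le_max_left _ _
      · exact le_max_right _ _
    exact this.continuousOn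
  · filter_upwards [hm, hXc, hpc, hi] with ω h1 h2 h3 h4
    refine tendsto_sum_integral_of_close (f := fun r s => A (t - s) (X r ω) (p r ω)) ht h4
      (fun r hr => hAi _ (h1 r hr) _) fun ε hε => ?_
    have h5 := isCompact_Icc.uniformContinuousOn_of_continuous (h2.prodMk h3)
    rw [Metric.uniformContinuousOn_iff] at h5
    obtain ⟨δ, hδ, h6⟩ := h5 (ε / (a + c + 1)) (by positivity)
    refine ⟨δ, hδ, fun r hr s hs hrs => ?_⟩
    have h7 := h6 s hs r hr (by rwa [Real.dist_eq])
    rw [Prod.dist_eq, max_lt_iff, dist_comm, dist_eq_norm, dist_comm, dist_eq_norm] at h7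
    refine (hA (t - s) ⟨by linarith [hs.2], by linarith [hs.1]⟩ _ (h1 r hr) _ (h1 s hs)
      _ _).trans ?_
    calc a * ‖X r ω - X s ω‖ + c * ‖p r ω - p s ω‖ ≤
        a * (ε / (a + c + 1)) + c * (ε / (a + c + 1)) := by
          gcongr
          · exact h7.1.le
          · exact h7.2.le
      _ = ε * ((a + c) / (a + c + 1)) := by ring
      _ ≤ ε * 1 := by
          gcongr
          rw [div_le_one (by positivity)]; linarith
      _ = ε := mul_one _

/-! ### Multidimensional Brownian motion -/

section BM

variable {m : ℕ} {S : Type*} [mS : MeasurableSpace S] {P : Measure S}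
  {W : ℝ≥0 → S → EuclideanSpace ℝ (Fin m)}

lemma continuous_euclidean_of_coord {α : Type*} [TopologicalSpace α] {m : ℕ}
    {f : α → EuclideanSpace ℝ (Fin m)} (h : ∀ i, Continuous fun a => f a i) : Continuous f := by
  have := (PiLp.continuous_toLp 2 (fun _ : Fin m => ℝ)).comp (continuous_pi h)
  exact this

lemma measurable_euclidean_of_coord {α : Type*} [MeasurableSpace α] {m : ℕ}
    {f : α → EuclideanSpace ℝ (Fin m)} (h : ∀ i, Measurable fun a => f a i) : Measurable f := by
  have := (MeasurableEquiv.toLp 2 (Fin m → ℝ)).measurable.comp (measurable_pi_iff.2 h)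
  exact this

lemma measurable_euclidean_coord {m : ℕ} (i : Fin m) :
    Measurable fun z : EuclideanSpace ℝ (Fin m) => z i := by fun_prop

lemma IsBrownianMotion.ae_continuous (hW : IsBrownianMotion W P) :
    ∀ᵐ ω ∂P, Continuous fun t => W t ω := by
  filter_upwards [ae_all_iff.2 fun i => (hW.coord i).cont] with ω h
  exact continuous_euclidean_of_coord h

lemma IsBrownianMotion.ae_zero (hW : IsBrownianMotion W P) : ∀ᵐ ω ∂P, W 0 ω = 0 := by
  filter_upwards [ae_all_iff.2 fun i => (hW.coord i).eval_zero_ae_eq_zero] with ω h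
  ext i
  simpa using h i

lemma pastOf_le (hW : ∀ t, Measurable (W t)) (s : ℝ) : pastOf W s ≤ mS :=
  iSup_le fun r => iSup_le fun _ => (hW r).comap_le

lemma IsBrownianMotion.shift (hW : IsBrownianMotion W P) (h : ℝ≥0) :
    IsBrownianMotion (fun t ω => W (h + t) ω - W h ω) P where
  measurable t := (hW.measurable _).sub (hW.measurable _)
  coord i := (hW.coord i).shift h
  indep := by
    have := hW.indep.comp (fun _ (f : ℝ≥0 → ℝ) (t : ℝ≥0) => f (h + t) - f h) (fun _ => by fun_prop)
    exact this

/-- If the pairs `(𝒜 i, ℬ i)` are independent of each other, and `𝒜 i` is independent of `ℬ i`,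
then `⨆ i, 𝒜 i` is independent of `⨆ i, ℬ i`. -/
lemma indep_iSup_iSup {ι : Type*} [Fintype ι] [IsProbabilityMeasure P]
    {𝒜 ℬ 𝒞 : ι → MeasurableSpace S} (h𝒞 : ∀ i, 𝒞 i ≤ mS) (hA : ∀ i, 𝒜 i ≤ 𝒞 i)
    (hB : ∀ i, ℬ i ≤ 𝒞 i) (hi : iIndep 𝒞 P) (hAB : ∀ i, Indep (𝒜 i) (ℬ i) P) :
    Indep (⨆ i, 𝒜 i) (⨆ i, ℬ i) P := by
  let π : (ι → MeasurableSpace S) → Set (Set S) := fun 𝒟 =>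
    {s | ∃ D : ι → Set S, (∀ i, MeasurableSet[𝒟 i] (D i)) ∧ s = ⋂ i, D i}
  have hπ : ∀ 𝒟, IsPiSystem (π 𝒟) := by
    rintro 𝒟 _ ⟨D, hD, rfl⟩ _ ⟨D', hD', rfl⟩ _
    exact ⟨fun i => D i ∩ D' i, fun i => (hD i).inter (hD' i), iInter_inter_distrib _ _ |>.symm⟩
  have hgen : ∀ 𝒟 : ι → MeasurableSpace S, ⨆ i, 𝒟 i = MeasurableSpace.generateFrom (π 𝒟) := by
    classical
    intro 𝒟
    refine le_antisymm (iSup_le fun i s hs => ?_) (MeasurableSpace.generateFrom_le ?_)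
    · refine MeasurableSpace.measurableSet_generateFrom
        ⟨fun j => if j = i then s else univ, fun j => ?_, ?_⟩
      · beta_reduce
        split_ifs with h
        · rw [h]; exact hs
        · exact MeasurableSet.univ
      · ext ω
        simp only [mem_iInter]
        refine ⟨fun h j => ?_, fun h => by simpa using h i⟩
        split_ifs
        · exact h
        · trivial
    · rintro _ ⟨D, hD, rfl⟩
      exact MeasurableSet.iInter fun i => le_iSup 𝒟 i _ (hD i)
  refine IndepSets.indep (iSup_le fun i => (hA i).trans (h𝒞 i))
    (iSup_le fun i => (hB i).trans (h𝒞 i)) (hπ 𝒜) (hπ ℬ) (hgen 𝒜) (hgen ℬ) ?_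
  rw [IndepSets_iff]
  rintro _ _ ⟨D, hD, rfl⟩ ⟨D', hD', rfl⟩
  rw [← iInter_inter_distrib, hi.meas_iInter fun i => (hA i _ (hD i)).inter (hB i _ (hD' i)),
    hi.meas_iInter fun i => hA i _ (hD i), hi.meas_iInter fun i => hB i _ (hD' i),
    ← Finset.prod_mul_distrib]
  exact Finset.prod_congr rfl fun i _ => Indep_iff _ _ _ |>.1 (hAB i) _ _ (hD i) (hD' i)

/-- The increments of a Brownian motion after time `h` are independent of its past. -/
lemma IsBrownianMotion.indep_shift [IsProbabilityMeasure P] (hW : IsBrownianMotion W P) {h t : ℝ}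
    (hh : 0 ≤ h) :
    Indep (pastOf (fun r ω => W (h.toNNReal + r) ω - W h.toNNReal ω) t) (pastOf W h) P := by
  set h' := h.toNNReal
  have hm : ∀ i t, Measurable fun ω => W t ω i := fun i t =>
    (measurable_euclidean_coord i).comp (hW.measurable t)
  let 𝒞 : Fin m → MeasurableSpace S := fun i =>
    MeasurableSpace.comap (fun ω (t : ℝ≥0) => W t ω i) MeasurableSpace.pi
  let 𝒜 : Fin m → MeasurableSpace S := fun i =>
    MeasurableSpace.comap (fun ω (t : ℝ≥0) => W (h' + t) ω i - W h' ω i) MeasurableSpace.pi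
  let ℬ : Fin m → MeasurableSpace S := fun i =>
    MeasurableSpace.comap (fun ω (t : Set.Iic h') => W t ω i) MeasurableSpace.pi
  have key : Indep (⨆ i, 𝒜 i) (⨆ i, ℬ i) P := by
    refine indep_iSup_iSup (𝒞 := 𝒞) (fun i => (measurable_pi_iff.2 (hm i)).comap_le)
      (fun i => ?_) (fun i => ?_) hW.indep fun i => (hW.coord i).indepFun_shift h'
    · rintro _ ⟨s, hs, rfl⟩
      have h1 : Measurable fun (f : ℝ≥0 → ℝ) (t : ℝ≥0) => f (h' + t) - f h' := by fun_prop
      exact ⟨_, h1 hs, rfl⟩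
    · rintro _ ⟨s, hs, rfl⟩
      have h1 : Measurable fun (f : ℝ≥0 → ℝ) (t : Set.Iic h') => f t := by fun_prop
      exact ⟨_, h1 hs, rfl⟩
  refine indep_of_indep_of_le_left (indep_of_indep_of_le_right key ?_) ?_
  · refine iSup_le fun r => iSup_le fun hr => ?_
    rw [← measurable_iff_comap_le]
    refine @measurable_euclidean_of_coord _ (⨆ i, ℬ i) _ _ fun i => ?_
    have hr' : r ∈ Set.Iic h' := by
      rw [mem_Iic, ← NNReal.coe_le_coe, Real.coe_toNNReal _ hh]; exact hr
    have h1 : Measurable[ℬ i] fun ω (t : Set.Iic h') => W t ω i := comap_measurable _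
    exact ((measurable_pi_apply (⟨r, hr'⟩ : Set.Iic h')).comp h1).mono (le_iSup ℬ i) le_rfl
  · refine iSup_le fun r => iSup_le fun hr => ?_
    rw [← measurable_iff_comap_le]
    refine @measurable_euclidean_of_coord _ (⨆ i, 𝒜 i) _ _ fun i => ?_
    have h1 : Measurable[𝒜 i] fun ω (t : ℝ≥0) => W (h' + t) ω i - W h' ω i := comap_measurable _
    exact ((measurable_pi_apply r).comp h1).mono (le_iSup 𝒜 i) le_rfl

/-- Trades the first moment of `W` for the coordinate variances, which are explicit; the loss is
harmless because only some finite bound is needed. -/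
lemma norm_le_one_add_sum_sq (z : EuclideanSpace ℝ (Fin m)) : ‖z‖ ≤ 1 + ∑ i, z i ^ 2 := by
  rw [← EuclideanSpace.real_norm_sq_eq]
  nlinarith [sq_nonneg (‖z‖ - 1), norm_nonneg z]

lemma IsBrownianMotion.integrable_sq (hW : IsBrownianMotion W P) (t : ℝ≥0) (i : Fin m) :
    Integrable (fun ω => W t ω i ^ 2) P :=
  ((hW.coord i).hasLaw_eval t).hasGaussianLaw.memLp_two.integrable_sq

lemma IsBrownianMotion.integrable_norm [IsProbabilityMeasure P] (hW : IsBrownianMotion W P)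
    (t : ℝ≥0) : Integrable (fun ω => ‖W t ω‖) P := by
  refine Integrable.mono' (g := fun ω => 1 + ∑ i, W t ω i ^ 2)
    ((integrable_const 1).add (integrable_finsetSum _ fun i _ => hW.integrable_sq t i))
    (hW.measurable t).norm.aestronglyMeasurable (.of_forall fun ω => ?_)
  rw [norm_norm]
  exact norm_le_one_add_sum_sq _

lemma IsBrownianMotion.integral_norm_le [IsProbabilityMeasure P] (hW : IsBrownianMotion W P)
    (t : ℝ≥0) : ∫ ω, ‖W t ω‖ ∂P ≤ 1 + m * t := by
  have h1 : ∀ i, ∫ ω, W t ω i ^ 2 ∂P = t := fun i => by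
    have h := ((hW.coord i).hasLaw_eval t).variance_eq
    rw [variance_id_gaussianReal, variance_eq_integral ((hW.coord i).aemeasurable t),
      (hW.coord i).integral_eval t] at h
    simpa using h
  calc ∫ ω, ‖W t ω‖ ∂P ≤ ∫ ω, (1 + ∑ i, W t ω i ^ 2) ∂P :=
        integral_mono (hW.integrable_norm t)
          ((integrable_const 1).add (integrable_finsetSum _ fun i _ => hW.integrable_sq t i))
          fun ω => norm_le_one_add_sum_sq _
    _ = 1 + m * t := by
        rw [integral_add (integrable_const 1)
          (integrable_finsetSum _ fun i _ => hW.integrable_sq t i),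
          integral_finsetSum _ fun i _ => hW.integrable_sq t i]
        simp [h1]

/-- A weighted time average of `‖W‖` is integrable, with the expected bound on its mean. -/
lemma IsBrownianMotion.exists_integrable_weighted [IsProbabilityMeasure P]
    (hW : IsBrownianMotion W P) {t T : ℝ} (ht : 0 ≤ t) (htT : t ≤ T) {η : ℝ → ℝ}
    (hη : Continuous η) (hη0 : ∀ s ∈ Icc 0 t, 0 ≤ η s) :
    ∃ Y : S → ℝ, Integrable Y P ∧
      (∀ᵐ ω ∂P, ∫ s in (0 : ℝ)..t, η s * ‖W s.toNNReal ω‖ = Y ω) ∧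
      ∫ ω, Y ω ∂P ≤ (1 + m * T) * ∫ s in (0 : ℝ)..t, η s := by
  classical
  -- Setting the paths to zero on a measurable null set containing all discontinuous ones makes `u`
  -- continuous in time for every `ω`, hence jointly measurable, and Fubini applies.
  set N := toMeasurable P {ω | ¬ Continuous fun t => W t ω}
  have hN : P N = 0 := by
    rw [measure_toMeasurable]; exact ae_iff.1 hW.ae_continuous
  have hNm : MeasurableSet N := measurableSet_toMeasurable _ _
  let u : ℝ → S → ℝ := fun s ω => ‖if ω ∈ N then 0 else W s.toNNReal ω‖
  have huc : ∀ ω, Continuous fun s => u s ω := by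
    intro ω
    by_cases h : ω ∈ N
    · simp only [u, h, if_true]; exact continuous_const
    · have hc : Continuous fun t => W t ω := by
        by_contra h'
        exact h (subset_toMeasurable _ _ h')
      simp only [u, h, if_false]
      exact (hc.comp continuous_real_toNNReal).norm
  have hum : ∀ s, Measurable (u s) := fun s =>
    (Measurable.ite hNm measurable_const (hW.measurable _)).norm
  have hu : Measurable (Function.uncurry u) := measurable_uncurry_of_continuous_of_measurable huc hum
  have huW : ∀ᵐ ω ∂P, ∀ s, u s ω = ‖W s.toNNReal ω‖ := by
    filter_upwards [measure_eq_zero_iff_ae_notMem.1 hN] with ω hω s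
    simp [u, hω]
  have hui : ∀ s, Integrable (u s) P := fun s =>
    (hW.integrable_norm s.toNNReal).congr (huW.mono fun ω h => (h s).symm)
  have hu0 : ∀ s ω, 0 ≤ u s ω := fun s ω => norm_nonneg _
  have huE : ∀ s ∈ Icc 0 t, ∫ ω, u s ω ∂P ≤ 1 + m * T := fun s hs => by
    rw [integral_congr_ae (huW.mono fun ω h => h s)]
    refine (hW.integral_norm_le _).trans ?_
    rw [Real.coe_toNNReal _ hs.1]
    have := hs.2
    gcongr
    linarith
  let f : ℝ → S → ℝ := fun s ω => η s * u s ω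
  have hfm : Measurable (Function.uncurry f) := (hη.measurable.comp measurable_fst).mul hu
  have hηi : IntegrableOn η (Ioc 0 t) :=
    (intervalIntegrable_iff_integrableOn_Ioc_of_le ht).1 (hη.intervalIntegrable 0 t)
  have hfi : Integrable (Function.uncurry f) ((volume.restrict (Ioc 0 t)).prod P) := by
    rw [integrable_prod_iff hfm.aestronglyMeasurable]
    refine ⟨.of_forall fun s => (hui s).const_mul (η s), ?_⟩
    refine Integrable.mono' (hηi.mul_const (1 + m * T))
      hfm.aestronglyMeasurable.norm.integral_prod_right' ?_
    refine (ae_restrict_iff' measurableSet_Ioc).2 (.of_forall fun s hs => ?_)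
    have hs' : s ∈ Icc 0 t := ⟨hs.1.le, hs.2⟩
    rw [Real.norm_of_nonneg (integral_nonneg fun _ => norm_nonneg _)]
    have e : ∀ ω, ‖Function.uncurry f (s, ω)‖ = η s * u s ω := fun ω =>
      Real.norm_of_nonneg (mul_nonneg (hη0 s hs') (hu0 s ω))
    simp_rw [e]
    rw [integral_const_mul]
    exact mul_le_mul_of_nonneg_left (huE s hs') (hη0 s hs')
  refine ⟨fun ω => ∫ s in (0 : ℝ)..t, f s ω, ?_, ?_, ?_⟩
  · simp_rw [intervalIntegral.integral_of_le ht]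
    exact hfi.integral_prod_right
  · filter_upwards [huW] with ω h
    simp only [f, h]
  · simp_rw [intervalIntegral.integral_of_le ht]
    rw [← integral_integral_swap hfi, mul_comm, ← integral_mul_const]
    refine setIntegral_mono_on ?_ (hηi.mul_const _) measurableSet_Ioc fun s hs => ?_
    · exact hfi.integral_prod_left
    · have hs' : s ∈ Icc 0 t := ⟨hs.1.le, hs.2⟩
      simp only [f]
      rw [integral_const_mul]
      exact mul_le_mul_of_nonneg_left (huE s hs') (hη0 s hs')

end BM

/-! ### Conditioning on the past by countable partitions -/

/-- A substitute for conditioning on `ξ`. The `𝓜`-measurable cells where `ξ` is first within `ε` of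
`z n` cover almost everything. On such a cell `D` is close to `D' n`, which is independent of the
cell and therefore contributes its mean times the probability of the cell. Summing over cells and
letting `ε → 0` gives the bound; no joint measurability in the point `z n` is involved. -/
lemma norm_integral_le_of_cells {S V E : Type*} {𝓜 𝓝 m0 : MeasurableSpace S} {P : Measure S}
    [IsProbabilityMeasure P] [PseudoMetricSpace V] [NormedAddCommGroup E]
    [NormedSpace ℝ E] [CompleteSpace E] (h𝓜 : 𝓜 ≤ m0) (h𝓝 : 𝓝 ≤ m0) (hind : Indep 𝓝 𝓜 P)
    {ξ : S → V} (hξ : AEStronglyMeasurable[𝓜] ξ P) {z : ℕ → V}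
    (hz : ∀ᵐ ω ∂P, ∀ ε > 0, ∃ n, dist (ξ ω) (z n) < ε) {D : S → E} {D' : ℕ → S → E} {κ β C : ℝ}
    (hC : 0 ≤ C) (hD : Integrable D P) (hD' : ∀ n, Integrable (D' n) P)
    (hDm : ∀ n, AEStronglyMeasurable[𝓝] (D' n) P)
    (hDD : ∀ n, ∀ᵐ ω ∂P, ‖D ω - D' n ω‖ ≤ κ + C * dist (ξ ω) (z n))
    (hDE : ∀ n, ∀ᵐ ω ∂P, ‖∫ ω', D' n ω' ∂P‖ ≤ β + C * dist (ξ ω) (z n)) :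
    ‖∫ ω, D ω ∂P‖ ≤ κ + β := by
  obtain ⟨ξ', hξ', hξξ⟩ := hξ
  have key : ∀ ε > 0, ‖∫ ω, D ω ∂P‖ ≤ κ + β + 2 * C * ε := by
    intro ε hε
    let B : ℕ → Set S := disjointed fun n => {ω | dist (ξ' ω) (z n) < ε}
    have hBm' : ∀ n, MeasurableSet[𝓜] (B n) := fun n =>
      MeasurableSet.disjointed (mα := 𝓜) (fun n =>
        StronglyMeasurable.measurableSet_lt (m := 𝓜) (hξ'.dist stronglyMeasurable_const)
          stronglyMeasurable_const) n
    have hBm : ∀ n, MeasurableSet (B n) := fun n => h𝓜 _ (hBm' n)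
    have hBd : Pairwise (Function.onFun Disjoint B) := disjoint_disjointed _
    have hBU : ∀ᵐ ω ∂P, ω ∈ ⋃ n, B n := by
      filter_upwards [hz, hξξ] with ω h1 h2
      obtain ⟨n, hn⟩ := h1 ε hε
      rw [iUnion_disjointed]
      exact mem_iUnion.2 ⟨n, by rw [mem_ofPred_eq, ← h2]; exact hn⟩
    have hBs : ∀ n, ∀ ω ∈ B n, dist (ξ' ω) (z n) < ε := fun n ω hω =>
      disjointed_subset (fun n => {ω | dist (ξ' ω) (z n) < ε}) n hω
    have hcell : ∀ n, ‖∫ ω in B n, D ω ∂P‖ ≤ (κ + β + 2 * C * ε) * P.real (B n) := by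
      intro n
      rcases eq_or_ne (P (B n)) 0 with h0 | h0
      · rw [Measure.restrict_eq_zero.2 h0, integral_zero_measure, norm_zero, measureReal_def, h0]
        simp
      -- Independence enters here: the conditional expectation of `D' n` given `𝓜` is constant.
      have hexp : ∫ ω in B n, D' n ω ∂P = P.real (B n) • ∫ ω, D' n ω ∂P := by
        obtain ⟨g, hg, hgD⟩ := hDm n
        have hgi : Integrable g P := (hD' n).congr hgD
        have h1 := condExp_indep_eq h𝓝 h𝓜 hg hind
        rw [integral_congr_ae (ae_restrict_of_ae hgD), integral_congr_ae hgD,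
          ← setIntegral_condExp h𝓜 hgi (hBm' n), integral_congr_ae (ae_restrict_of_ae h1),
          setIntegral_const]
      have hβ : ‖∫ ω, D' n ω ∂P‖ ≤ β + C * ε := by
        -- The bound on the mean of `D' n` is only known almost surely in `ω`; a cell of positive
        -- probability contains a point where it holds.
        have h1 : ∃ᵐ ω ∂P, ω ∈ B n := frequently_ae_mem_iff.2 h0
        obtain ⟨ω, h2, h3, h4⟩ := (h1.and_eventually ((hDE n).and hξξ)).exists
        refine h3.trans ?_
        have := hBs n ω h2
        rw [h4]
        gcongr
      have h1 : ‖∫ ω in B n, (D ω - D' n ω) ∂P‖ ≤ (κ + C * ε) * P.real (B n) := by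
        refine norm_setIntegral_le_of_norm_le_const_ae' (measure_lt_top _ _) ?_
        filter_upwards [hDD n, hξξ] with ω h2 h3 h4
        refine h2.trans ?_
        have := hBs n ω h4
        rw [h3]
        gcongr
      have h2 : ∫ ω in B n, D ω ∂P = (∫ ω in B n, (D ω - D' n ω) ∂P) +
          P.real (B n) • ∫ ω, D' n ω ∂P := by
        rw [integral_sub hD.integrableOn (hD' n).integrableOn, hexp]; abel
      rw [h2]
      refine (norm_add_le _ _).trans ?_
      rw [norm_smul, Real.norm_of_nonneg measureReal_nonneg]
      have : P.real (B n) * ‖∫ ω, D' n ω ∂P‖ ≤ P.real (B n) * (β + C * ε) := by gcongr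
      linarith
    have hs1 := hasSum_integral_iUnion hBm hBd hD.integrableOn (f := D) (μ := P)
    have hs2 : HasSum (fun n => P.real (B n)) 1 := by
      have h1 := hasSum_integral_iUnion hBm hBd (integrable_const (1 : ℝ)).integrableOn
        (f := fun _ => (1 : ℝ)) (μ := P)
      rw [Measure.restrict_eq_self_of_ae_mem hBU] at h1
      simpa using h1
    rw [Measure.restrict_eq_self_of_ae_mem hBU] at hs1
    have := hs1.norm_le_of_bounded (hs2.mul_left (κ + β + 2 * C * ε)) hcell
    simpa using this
  refine le_of_forall_pos_le_add fun ε hε => ?_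
  have := key (ε / (2 * C + 1)) (by positivity)
  have h2 : 2 * C * (ε / (2 * C + 1)) ≤ ε := by
    rw [mul_div_assoc', div_le_iff₀ (by positivity)]; nlinarith
  linarith

/-! ### Time regularity of the coefficients of a Feynman–Kac representation -/

lemma IsBrownianMotion.ae_continuousOn_noise {m : ℕ} {S : Type*} [MeasurableSpace S]
    {P : Measure S} {W : ℝ≥0 → S → EuclideanSpace ℝ (Fin m)} (hW : IsBrownianMotion W P) (σ : ℝ) :
    ∀ᵐ ω ∂P, ∀ t, ContinuousOn (fun s : ℝ => Real.sqrt (2 * σ) • W s.toNNReal ω) (Icc 0 t) := by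
  filter_upwards [hW.ae_continuous] with ω h t
  exact ((h.comp continuous_real_toNNReal).const_smul (Real.sqrt (2 * σ))).continuousOn

section FK

variable {d m : ℕ} {S : Type*} [MeasurableSpace S] {P : Measure S} [IsProbabilityMeasure P]
  {Ω : Set (EuclideanSpace ℝ (Fin d))} {σ : ℝ}
  {b : EuclideanSpace ℝ (Fin m) → EuclideanSpace ℝ (Fin m)} {T : ℝ}
  {A B : ℝ → EuclideanSpace ℝ (Fin d) → EuclideanSpace ℝ (Fin m) → EuclideanSpace ℝ (Fin d)}
  {U₀ : EuclideanSpace ℝ (Fin d) → EuclideanSpace ℝ (Fin m) → EuclideanSpace ℝ (Fin d)}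
  {V : ℝ → EuclideanSpace ℝ (Fin d) → EuclideanSpace ℝ (Fin m) → EuclideanSpace ℝ (Fin d)}
  {W : ℝ≥0 → S → EuclideanSpace ℝ (Fin m)}

/-- The representation gives integrability of `A` only along characteristics. One started at `(x,
q)` with horizon `t'`, read backwards in time, stays near `(x, q)` for `τ` just below `t'`, so `A τ
x q` is there close to a measurable function of `τ`. Integrability then follows by comparison along
the single characteristic with horizon `t`. -/
lemma IsFeynmanKac.intervalIntegrable_time (hFK : IsFeynmanKac P Ω σ b T A B U₀ V)
    (hW : IsBrownianMotion W P) {t a c : ℝ} (ht : t ∈ Ico 0 T)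
    (hA : LipOn Ω t a c A) {x : EuclideanSpace ℝ (Fin d)} (hx : x ∈ Ω)
    (q : EuclideanSpace ℝ (Fin m)) :
    IntervalIntegrable (fun τ => A τ x q) volume 0 t := by
  have path : ∀ t' ∈ Icc 0 t, ∃ (X : ℝ → EuclideanSpace ℝ (Fin d))
      (p : ℝ → EuclideanSpace ℝ (Fin m)), ContinuousOn X (Icc 0 t') ∧ ContinuousOn p (Icc 0 t') ∧
      X 0 = x ∧ p 0 = q ∧ (∀ s ∈ Icc 0 t', X s ∈ Ω) ∧
      IntervalIntegrable (fun s => A (t' - s) (X s) (p s)) volume 0 t' := by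
    intro t' ht'
    obtain ⟨X, p, hch, hi, -, -⟩ := hFK t' ⟨ht'.1, ht'.2.trans_lt ht.2⟩ x hx q W hW
    obtain ⟨ω, h1, h2, h3, h4⟩ := (hch.isPath.and (hi.and ((hW.ae_continuousOn_noise σ).and
      hW.ae_zero))).exists
    have h0 : (0 : ℝ) ∈ Icc 0 t' := ⟨le_rfl, ht'.1⟩
    refine ⟨_, _, h1.continuousOn_X ht'.1, h1.continuousOn_p ht'.1 (h3 t'), ?_, ?_, h1.mem, h2⟩
    · simpa using h1.eq_X 0 h0
    · simpa [h4] using h1.eq_p 0 h0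
  have hmeas : AEStronglyMeasurable (fun τ => A τ x q) (volume.restrict (Ioc 0 t)) := by
    refine aestronglyMeasurable_of_left_approx fun ε hε t' ht' => ?_
    obtain ⟨X, p, hX, hp, hX0, hp0, hm, hi⟩ := path t' ⟨ht'.1.le, ht'.2⟩
    have h0 : (0 : ℝ) ∈ Icc 0 t' := ⟨le_rfl, ht'.1.le⟩
    have hcont : ContinuousWithinAt (fun s => a * ‖x - X s‖ + c * ‖q - p s‖) (Icc 0 t') 0 :=
      ((((continuousOn_const.sub hX).norm.const_mul a).add
        ((continuousOn_const.sub hp).norm.const_mul c))) 0 h0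
    rw [Metric.continuousWithinAt_iff] at hcont
    obtain ⟨δ, hδ, hcl⟩ := hcont ε hε
    refine ⟨min δ t', lt_min hδ ht'.1, fun τ => A τ (X (t' - τ)) (p (t' - τ)), ?_, ?_⟩
    · have h1 := hi.comp_sub_left t'
      simp only [sub_sub_cancel, sub_zero, sub_self] at h1
      refine h1.symm.1.aestronglyMeasurable.mono_set ?_
      intro τ hτ
      have := min_le_right δ t'
      exact ⟨by linarith [hτ.1], hτ.2.le⟩
    · intro τ hτ
      have h1 := min_le_right δ t'
      have h2 := min_le_left δ t'
      have hs : t' - τ ∈ Icc 0 t' := ⟨by linarith [hτ.2], by linarith [hτ.1]⟩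
      refine (hA τ ⟨by linarith [hτ.1], by linarith [hτ.2, ht'.2]⟩ _ hx _ (hm _ hs) _ _).trans ?_
      have h3 := hcl hs (by
        rw [Real.dist_eq, sub_zero, abs_of_nonneg hs.1]; linarith [hτ.1])
      rw [hX0, hp0] at h3
      simp only [sub_self, norm_zero, mul_zero, add_zero, Real.dist_eq, sub_zero] at h3
      exact (le_abs_self _).trans h3.le
  obtain ⟨X, p, hX, hp, hX0, hp0, hm, hi⟩ := path t ⟨ht.1, le_rfl⟩
  have h1 := hi.comp_sub_left t
  simp only [sub_sub_cancel, sub_zero, sub_self] at h1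
  have hcm : ContinuousOn (fun τ => a * ‖x - X (t - τ)‖ + c * ‖q - p (t - τ)‖) (Icc 0 t) := by
    have hg : ContinuousOn (fun τ : ℝ => t - τ) (Icc 0 t) := by fun_prop
    have hmap : MapsTo (fun τ : ℝ => t - τ) (Icc 0 t) (Icc 0 t) := fun τ hτ =>
      ⟨by simpa using hτ.2, by simpa using hτ.1⟩
    exact ((continuousOn_const.sub (hX.comp hg hmap)).norm.const_mul a).add
        ((continuousOn_const.sub (hp.comp hg hmap)).norm.const_mul c)
  have h2 := hcm.intervalIntegrable_zero ht.1
  rw [intervalIntegrable_iff_integrableOn_Ioc_of_le ht.1] at h2 ⊢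
  have h3 := (intervalIntegrable_iff_integrableOn_Ioc_of_le ht.1).1 h1.symm
  refine Integrable.mono' (h2.add h3.norm) hmeas ?_
  refine (ae_restrict_iff' measurableSet_Ioc).2 (.of_forall fun τ hτ => ?_)
  have hτ' : t - τ ∈ Icc 0 t := ⟨by linarith [hτ.2], by linarith [hτ.1]⟩
  have h4 := hA τ ⟨hτ.1.le, hτ.2⟩ _ hx _ (hm _ hτ') q (p (t - τ))
  have h5 : ‖A τ x q‖ ≤ ‖A τ x q - A τ (X (t - τ)) (p (t - τ))‖ +
      ‖A τ (X (t - τ)) (p (t - τ))‖ := by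
    simpa using norm_add_le (A τ x q - A τ (X (t - τ)) (p (t - τ))) (A τ (X (t - τ)) (p (t - τ)))
  simp only [Pi.add_apply]
  linarith

end FK

/-! ### Restarting a characteristic -/

section Path

variable {E E' : Type*} [NormedAddCommGroup E] [NormedSpace ℝ E]
  [NormedAddCommGroup E'] [NormedSpace ℝ E'] {Ω : Set E} {b : E' → E'}
  {B : ℝ → E → E' → E} {t : ℝ} {x : E} {q : E'}
  {w w' : ℝ → E'} {X : ℝ → E} {p : ℝ → E'}

lemma IsPath.congr_noise (H : IsPath Ω b B t x q w X p) (hw : ∀ s ∈ Icc 0 t, w s = w' s) :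
    IsPath Ω b B t x q w' X p :=
  ⟨H.mem, H.integrable_X, H.integrable_p, H.eq_X, fun s hs => by rw [H.eq_p s hs, hw s hs]⟩

end Path

lemma intervalIntegrable_shift {E E' : Type*} [NormedAddCommGroup E]
    {A : ℝ → E → E' → E} {t h : ℝ} {X : ℝ → E} {p : ℝ → E'} (ht : 0 ≤ t) (hh : 0 ≤ h)
    (hi : IntervalIntegrable (fun s => A (t + h - s) (X s) (p s)) volume 0 (t + h)) :
    IntervalIntegrable (fun s => A (t - s) (X (h + s)) (p (h + s))) volume 0 t := by
  have := (intervalIntegrable_sub_of_mem hi (r := h) (s := h + t) ⟨hh, by linarith⟩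
    ⟨by linarith, by linarith⟩).comp_add_left h
  simp only [sub_self, add_sub_cancel_left] at this
  refine this.congr fun s _ => ?_
  congr 1; ring

lemma payoff_add {E E' : Type*} [NormedAddCommGroup E] [NormedSpace ℝ E] [NormedAddCommGroup E']
    {A : ℝ → E → E' → E} {U₀ : E → E' → E} {t h : ℝ} {X : ℝ → E} {p : ℝ → E'} (ht : 0 ≤ t) (hh : 0 ≤ h)
    (hi : IntervalIntegrable (fun s => A (t + h - s) (X s) (p s)) volume 0 (t + h)) :
    payoff A U₀ (t + h) X p = (∫ s in (0 : ℝ)..h, A (t + h - s) (X s) (p s)) +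
      payoff A U₀ t (fun s => X (h + s)) (fun s => p (h + s)) := by
  have mh : h ∈ Icc 0 (t + h) := ⟨hh, by linarith⟩
  have e : ∫ s in (0 : ℝ)..t, A (t - s) (X (h + s)) (p (h + s)) =
      ∫ s in h..(t + h), A (t + h - s) (X s) (p s) := by
    have h1 := intervalIntegral.integral_comp_add_left (a := 0) (b := t)
      (fun s => A (t + h - s) (X s) (p s)) h
    rw [add_zero, add_comm h t] at h1
    rw [← h1]
    refine intervalIntegral.integral_congr fun s _ => ?_
    congr 1; ring
  unfold payoff
  rw [e, ← add_assoc, intervalIntegral.integral_add_adjacent_intervals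
    (intervalIntegrable_sub_of_mem hi ⟨le_rfl, by linarith⟩ mh)
    (intervalIntegrable_sub_of_mem hi mh ⟨by linarith, le_rfl⟩)]
  simp only [add_comm h t]

lemma LipOn.mono {E E' : Type*} [NormedAddCommGroup E] [NormedAddCommGroup E'] {Ω : Set E}
    {A : ℝ → E → E' → E} {a c t t' : ℝ} (hA : LipOn Ω t a c A) (h : t' ≤ t) : LipOn Ω t' a c A :=
  fun τ hτ => hA τ ⟨hτ.1, hτ.2.trans h⟩

lemma noise_shift {m : ℕ} {S : Type*} (W : ℝ≥0 → S → EuclideanSpace ℝ (Fin m)) (σ : ℝ) {h s : ℝ}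
    (hh : 0 ≤ h) (hs : 0 ≤ s) (ω : S) :
    Real.sqrt (2 * σ) • W (h + s).toNNReal ω - Real.sqrt (2 * σ) • W h.toNNReal ω =
      Real.sqrt (2 * σ) • (W (h.toNNReal + s.toNNReal) ω - W h.toNNReal ω) := by
  rw [← smul_sub, Real.toNNReal_add hh hs]

lemma pastOf_mono {m : ℕ} {S : Type*} [MeasurableSpace S]
    (W : ℝ≥0 → S → EuclideanSpace ℝ (Fin m)) {s t : ℝ} (h : s ≤ t) : pastOf W s ≤ pastOf W t :=
  iSup_le fun r => iSup_le fun hr => le_iSup₂_of_le r (hr.trans h) le_rfl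

lemma aestronglyMeasurable_mono_sigma {S E : Type*} {𝓜 𝓝 m0 : MeasurableSpace S} {P : Measure S}
    [TopologicalSpace E] {f : S → E} (hle : 𝓜 ≤ 𝓝) (hf : AEStronglyMeasurable[𝓜] f P) :
    AEStronglyMeasurable[𝓝] f P := by
  obtain ⟨g, hg, h⟩ := hf
  exact ⟨g, hg.mono hle, h⟩

/-! ### Dynamic programming for Feynman–Kac representations -/

section FK

variable {d m : ℕ} {S : Type*} [MeasurableSpace S] {P : Measure S} [IsProbabilityMeasure P]
  {Ω : Set (EuclideanSpace ℝ (Fin d))} {σ : ℝ}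
  {b : EuclideanSpace ℝ (Fin m) → EuclideanSpace ℝ (Fin m)} {T : ℝ}
  {A B : ℝ → EuclideanSpace ℝ (Fin d) → EuclideanSpace ℝ (Fin m) → EuclideanSpace ℝ (Fin d)}
  {U₀ : EuclideanSpace ℝ (Fin d) → EuclideanSpace ℝ (Fin m) → EuclideanSpace ℝ (Fin d)}
  {V : ℝ → EuclideanSpace ℝ (Fin d) → EuclideanSpace ℝ (Fin m) → EuclideanSpace ℝ (Fin d)}
  {W : ℝ≥0 → S → EuclideanSpace ℝ (Fin m)}

lemma continuousOn_of_lipschitz_bound {k : ℝ} (hk : 0 ≤ k)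
    (hU₀ : ∀ x ∈ Ω, ∀ x' ∈ Ω, ∀ p p', ‖U₀ x p - U₀ x' p'‖ ≤ k * (‖x - x'‖ + ‖p - p'‖)) :
    ContinuousOn (fun z : EuclideanSpace ℝ (Fin d) × EuclideanSpace ℝ (Fin m) => U₀ z.1 z.2)
      (Ω ×ˢ univ) := by
  have : LipschitzOnWith (Real.toNNReal (2 * k)) (fun z : EuclideanSpace ℝ (Fin d) ×
      EuclideanSpace ℝ (Fin m) => U₀ z.1 z.2) (Ω ×ˢ univ) := by
    refine LipschitzOnWith.of_dist_le_mul fun z hz z' hz' => ?_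
    rw [dist_eq_norm, Real.coe_toNNReal _ (by positivity)]
    refine (hU₀ _ hz.1 _ hz'.1 _ _).trans ?_
    rw [Prod.dist_eq, dist_eq_norm, dist_eq_norm]
    nlinarith [le_max_left ‖z.1 - z'.1‖ ‖z.2 - z'.2‖, le_max_right ‖z.1 - z'.1‖ ‖z.2 - z'.2‖]
  exact this.continuousOn

/-- The Feynman–Kac representation, in terms of `payoff` and with its measurability. -/
lemma IsFeynmanKac.exists_characteristic (hΩ : IsOpen Ω)
    (hFK : IsFeynmanKac P Ω σ b T A B U₀ V)
    (hW : IsBrownianMotion W P) {t a c k : ℝ} (ha : 0 ≤ a) (hc : 0 ≤ c) (hk : 0 ≤ k)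
    (ht : t ∈ Ico 0 T) (hA : LipOn Ω t a c A)
    (hU₀ : ∀ x ∈ Ω, ∀ x' ∈ Ω, ∀ p p', ‖U₀ x p - U₀ x' p'‖ ≤ k * (‖x - x'‖ + ‖p - p'‖))
    {x : EuclideanSpace ℝ (Fin d)} (hx : x ∈ Ω) (q : EuclideanSpace ℝ (Fin m)) :
    ∃ (X : ℝ → S → EuclideanSpace ℝ (Fin d)) (p : ℝ → S → EuclideanSpace ℝ (Fin m)),
      (∀ s ∈ Icc 0 t, AEStronglyMeasurable[pastOf W s] (X s) P) ∧
      (∀ s ∈ Icc 0 t, AEStronglyMeasurable[pastOf W s] (p s) P) ∧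
      (∀ᵐ ω ∂P, IsPath Ω b B t x q (fun s => Real.sqrt (2 * σ) • W s.toNNReal ω)
        (fun s => X s ω) (fun s => p s ω)) ∧
      (∀ᵐ ω ∂P, IntervalIntegrable (fun s => A (t - s) (X s ω) (p s ω)) volume 0 t) ∧
      Integrable (fun ω => payoff A U₀ t (fun s => X s ω) (fun s => p s ω)) P ∧
      AEStronglyMeasurable[pastOf W t]
        (fun ω => payoff A U₀ t (fun s => X s ω) (fun s => p s ω)) P ∧
      V t x q = ∫ ω, payoff A U₀ t (fun s => X s ω) (fun s => p s ω) ∂P := by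
  obtain ⟨X, p, hch, hi, hint, hV⟩ := hFK t ht x hx q W hW
  refine ⟨X, p, hch.adapted_X, hch.adapted_p, hch.isPath, hi, hint, ?_, hV⟩
  refine aestronglyMeasurable_payoff hΩ ht.1 ha hc hA (fun x hx q => ?_)
    (continuousOn_of_lipschitz_bound hk hU₀)
    (fun s hs => aestronglyMeasurable_mono_sigma (pastOf_mono W hs.2) (hch.adapted_X s hs))
    (fun s hs => aestronglyMeasurable_mono_sigma (pastOf_mono W hs.2) (hch.adapted_p s hs))
    (hch.isPath.mono fun ω H => H.mem) (hch.isPath.mono fun ω H => H.continuousOn_X ht.1) ?_ hi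
  · have := (hFK.intervalIntegrable_time hW ht hA hx q).comp_sub_left t
    simp only [sub_self, sub_zero] at this
    exact this.symm
  · filter_upwards [hch.isPath, hW.ae_continuousOn_noise σ] with ω H hw
    exact H.continuousOn_p ht.1 (hw t)

/-- Dynamic programming over a time step `h`: a bound for the variation of `V(t + h)` in its last
variable, in terms of the Lipschitz constants of `V(t)`. -/
lemma IsFeynmanKac.norm_sub_le_step (hΩ : IsOpen Ω) (hFK : IsFeynmanKac P Ω σ b T A B U₀ V)
    (hW : IsBrownianMotion W P) {t h a c k β M N : ℝ} (ha : 0 ≤ a) (hc : 0 ≤ c) (hk : 0 ≤ k)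
    (hβ : 0 ≤ β) (hM : 0 ≤ M) (hN : 0 ≤ N) (ht : 0 ≤ t) (hh : 0 ≤ h) (hT : t + h < T)
    (hA : LipOn Ω (t + h) a c A) (hB : LipOn Ω (t + h) a c B)
    (hb : ∀ p p', ‖b p - b p'‖ ≤ β * ‖p - p'‖)
    (hU₀ : ∀ x ∈ Ω, ∀ x' ∈ Ω, ∀ p p', ‖U₀ x p - U₀ x' p'‖ ≤ k * (‖x - x'‖ + ‖p - p'‖))
    (hV : ∀ x ∈ Ω, ∀ x' ∈ Ω, ∀ p p', ‖V t x p - V t x' p'‖ ≤ M * ‖x - x'‖ + N * ‖p - p'‖)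
    {x : EuclideanSpace ℝ (Fin d)} (hx : x ∈ Ω) (q q' : EuclideanSpace ℝ (Fin m)) :
    ‖V (t + h) x q - V (t + h) x q'‖ ≤
      h * (a * (h * (c * (‖q - q'‖ * Real.exp (β * h))) * Real.exp (a * h)) +
        c * (‖q - q'‖ * Real.exp (β * h))) +
      (M * (h * (c * (‖q - q'‖ * Real.exp (β * h))) * Real.exp (a * h)) +
        N * (‖q - q'‖ * Real.exp (β * h))) := by
  have hth : t + h ∈ Ico 0 T := ⟨by linarith, hT⟩
  have hhm : h ∈ Icc 0 (t + h) := ⟨hh, by linarith⟩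
  obtain ⟨X, p, hXm, hpm, hP, hi, hint, -, hVx⟩ :=
    hFK.exists_characteristic hΩ hW ha hc hk hth hA hU₀ hx q
  obtain ⟨X', p', hXm', hpm', hP', hi', hint', -, hVx'⟩ :=
    hFK.exists_characteristic hΩ hW ha hc hk hth hA hU₀ hx q'
  have hAt : LipOn Ω t a c A := hA.mono (by linarith)
  have hBt : LipOn Ω t a c B := hB.mono (by linarith)
  -- The restarted characteristics are chosen for each starting point separately and are driven by
  -- the increments of `W` after `h`. Only the starting points in a dense sequence of pairs will be
  -- used.
  choose! Y r hYm hrm hY hYi hYint hYmeas hVY using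
    fun (x : EuclideanSpace ℝ (Fin d)) (hx : x ∈ Ω) (q : EuclideanSpace ℝ (Fin m)) =>
      hFK.exists_characteristic hΩ (hW.shift h.toNNReal) ha hc hk (t := t) ⟨ht, by linarith⟩
        hAt hU₀ hx q
  let 𝒟 : Set ((EuclideanSpace ℝ (Fin d) × EuclideanSpace ℝ (Fin m)) ×
    (EuclideanSpace ℝ (Fin d) × EuclideanSpace ℝ (Fin m))) := (Ω ×ˢ univ) ×ˢ (Ω ×ˢ univ)
  have : Nonempty 𝒟 := ⟨⟨((x, q), (x, q)), ⟨⟨hx, trivial⟩, ⟨hx, trivial⟩⟩⟩⟩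
  let z : ℕ → 𝒟 := TopologicalSpace.denseSeq 𝒟
  have hz1 : ∀ n, (z n).1.1.1 ∈ Ω := fun n => (z n).2.1.1
  have hz2 : ∀ n, (z n).1.2.1 ∈ Ω := fun n => (z n).2.2.1
  obtain ⟨C, hC, hCle⟩ := exists_norm_payoff_sub_le (Ω := Ω) ht ha hc hβ hb hBt hAt hk hU₀
  have hx0 : ‖x - x‖ = 0 := by simp
  have key := norm_integral_le_of_cells (pastOf_le hW.measurable h)
    (pastOf_le (hW.shift h.toNNReal).measurable t) (hW.indep_shift (t := t) hh)
    (ξ := fun ω => ((X h ω, p h ω), (X' h ω, p' h ω))) (z := fun n => (z n).1)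
    (D := fun ω => payoff A U₀ (t + h) (fun s => X s ω) (fun s => p s ω) -
      payoff A U₀ (t + h) (fun s => X' s ω) (fun s => p' s ω))
    (D' := fun n ω => payoff A U₀ t (fun s => Y (z n).1.1.1 (z n).1.1.2 s ω)
        (fun s => r (z n).1.1.1 (z n).1.1.2 s ω) -
      payoff A U₀ t (fun s => Y (z n).1.2.1 (z n).1.2.2 s ω)
        (fun s => r (z n).1.2.1 (z n).1.2.2 s ω))
    -- `κ` bounds the running payoffs over `[0, h]`, and the second constant bounds the variation of
    -- `V t` between the two states reached at time `h`.
    (κ := h * (a * (h * (c * (‖q - q'‖ * Real.exp (β * h))) * Real.exp (a * h)) +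
        c * (‖q - q'‖ * Real.exp (β * h))))
    (β := M * (h * (c * (‖q - q'‖ * Real.exp (β * h))) * Real.exp (a * h)) +
        N * (‖q - q'‖ * Real.exp (β * h)))
    -- With `R` the distance to the cell's centre, each of the two payoff comparisons costs `2 * C *
    -- R`, and moving both endpoints of `V t` to the centre costs `2 * (M + N) * R`; one constant
    -- dominates both totals.
    (C := 4 * C + 2 * M + 2 * N)
    ?_ ?_ (by positivity) (hint.sub hint') ?_ ?_ ?_ ?_
  · rw [integral_sub hint hint', ← hVx, ← hVx'] at key
    exact key
  · exact ((hXm h hhm).prodMk (hpm h hhm)).prodMk ((hXm' h hhm).prodMk (hpm' h hhm))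
  · filter_upwards [hP, hP'] with ω H H' ε hε
    obtain ⟨n, hn⟩ := (TopologicalSpace.denseRange_denseSeq 𝒟).exists_dist_lt
      (⟨((X h ω, p h ω), (X' h ω, p' h ω)),
        ⟨⟨H.mem h hhm, trivial⟩, ⟨H'.mem h hhm, trivial⟩⟩⟩ : 𝒟) hε
    exact ⟨n, hn⟩
  · exact fun n => (hYint _ (hz1 n) _).sub (hYint _ (hz2 n) _)
  · exact fun n => (hYmeas _ (hz1 n) _).sub (hYmeas _ (hz2 n) _)
  · intro n
    filter_upwards [hP, hP', hi, hi', hY _ (hz1 n) (z n).1.1.2, hY _ (hz2 n) (z n).1.2.2,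
      hYi _ (hz1 n) (z n).1.1.2, hYi _ (hz2 n) (z n).1.2.2] with ω H H' j j' H1 H2 j1 j2
    have n1 := H.norm_integral_sub_le ha hc hβ hb hB hA hhm H' j j'
    have cn := fun s (hs : s ∈ Icc 0 t) => noise_shift W σ hh hs.1 ω
    have n2 := hCle _ _ _ _ _ _ _ _ _ ((H.shift ht hh).congr_noise cn) H1
      (intervalIntegrable_shift ht hh j) j1
    have n3 := hCle _ _ _ _ _ _ _ _ _ ((H'.shift ht hh).congr_noise cn) H2
      (intervalIntegrable_shift ht hh j') j2
    rw [hx0, zero_add] at n1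
    simp only [payoff_add ht hh j, payoff_add ht hh j']
    set R := dist ((X h ω, p h ω), (X' h ω, p' h ω)) (z n).1 with hR
    simp only [dist_eq_norm] at hR
    have b1 : ‖X h ω - (z n).1.1.1‖ ≤ R := by
      rw [hR]; exact (le_max_left _ _).trans (le_max_left _ _)
    have b2 : ‖p h ω - (z n).1.1.2‖ ≤ R := by
      rw [hR]; exact (le_max_right _ _).trans (le_max_left _ _)
    have b3 : ‖X' h ω - (z n).1.2.1‖ ≤ R := by
      rw [hR]; exact (le_max_left _ _).trans (le_max_right _ _)
    have b4 : ‖p' h ω - (z n).1.2.2‖ ≤ R := by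
      rw [hR]; exact (le_max_right _ _).trans (le_max_right _ _)
    have hR0 : 0 ≤ R := (norm_nonneg _).trans b1
    have n2' := n2.trans (mul_le_mul_of_nonneg_left (add_le_add b1 b2) hC)
    have n3' := n3.trans (mul_le_mul_of_nonneg_left (add_le_add b3 b4) hC)
    have tri : ∀ a1 a2 r1 r2 y1 y2 : EuclideanSpace ℝ (Fin d),
        ‖(a1 + r1) - (a2 + r2) - (y1 - y2)‖ ≤ ‖a1 - a2‖ + ‖r1 - y1‖ + ‖r2 - y2‖ := by
      intro a1 a2 r1 r2 y1 y2
      have : (a1 + r1) - (a2 + r2) - (y1 - y2) = (a1 - a2) + (r1 - y1) - (r2 - y2) := by abel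
      rw [this]
      exact (norm_sub_le _ _).trans (by gcongr; exact norm_add_le _ _)
    refine (tri _ _ _ _ _ _).trans ?_
    nlinarith [mul_nonneg hM hR0, mul_nonneg hN hR0]
  · intro n
    filter_upwards [hP, hP'] with ω H H'
    rw [integral_sub (hYint _ (hz1 n) _) (hYint _ (hz2 n) _), ← hVY _ (hz1 n), ← hVY _ (hz2 n)]
    refine (hV _ (hz1 n) _ (hz2 n) _ _).trans ?_
    have hhh : h ∈ Icc 0 h := ⟨hh, le_rfl⟩
    have n1 := H.norm_X_sub_le ha hc hβ hb hB hhm H' h hhh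
    have n2 := H.norm_p_sub_le hβ hb H' h hhm
    rw [hx0, zero_add] at n1
    set R := dist ((X h ω, p h ω), (X' h ω, p' h ω)) (z n).1 with hR
    simp only [dist_eq_norm] at hR
    have b1 : ‖X h ω - (z n).1.1.1‖ ≤ R := by
      rw [hR]; exact (le_max_left _ _).trans (le_max_left _ _)
    have b2 : ‖p h ω - (z n).1.1.2‖ ≤ R := by
      rw [hR]; exact (le_max_right _ _).trans (le_max_left _ _)
    have b3 : ‖X' h ω - (z n).1.2.1‖ ≤ R := by
      rw [hR]; exact (le_max_left _ _).trans (le_max_right _ _)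
    have b4 : ‖p' h ω - (z n).1.2.2‖ ≤ R := by
      rw [hR]; exact (le_max_right _ _).trans (le_max_right _ _)
    have hR0 : 0 ≤ R := (norm_nonneg _).trans b1
    have tri : ∀ {F : Type} [NormedAddCommGroup F] (u u' y y' : F),
        ‖y - y'‖ ≤ ‖u - u'‖ + ‖u - y‖ + ‖u' - y'‖ := by
      intro F _ u u' y y'
      have : y - y' = (u - u') - (u - y) + (u' - y') := by abel
      rw [this]
      exact (norm_add_le _ _).trans (by gcongr; exact norm_sub_le _ _)
    have t1 : ‖(z n).1.1.1 - (z n).1.2.1‖ ≤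
        h * (c * (‖q - q'‖ * Real.exp (β * h))) * Real.exp (a * h) + 2 * R := by
      linarith [tri (X h ω) (X' h ω) (z n).1.1.1 (z n).1.2.1]
    have t2 : ‖(z n).1.1.2 - (z n).1.2.2‖ ≤ ‖q - q'‖ * Real.exp (β * h) + 2 * R := by
      linarith [tri (p h ω) (p' h ω) (z n).1.1.2 (z n).1.2.2]
    have t1' := mul_le_mul_of_nonneg_left t1 hM
    have t2' := mul_le_mul_of_nonneg_left t2 hN
    nlinarith [mul_nonneg hC hR0]

end FK

/-! ### Moments of the second component, growth and uniqueness -/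

lemma integrable_affine {S : Type*} [MeasurableSpace S] {P : Measure S} [IsProbabilityMeasure P]
    {Y Z : S → ℝ} (hY : Integrable Y P) (hZ : Integrable Z P) (u v w : ℝ) :
    Integrable (fun ω => u + v * Y ω + w * Z ω) P :=
  ((integrable_const u).add (hY.const_mul v)).add (hZ.const_mul w)

lemma integral_affine {S : Type*} [MeasurableSpace S] {P : Measure S} [IsProbabilityMeasure P]
    {Y Z : S → ℝ} (hY : Integrable Y P) (hZ : Integrable Z P) (u v w : ℝ) :
    ∫ ω, (u + v * Y ω + w * Z ω) ∂P = u + v * (∫ ω, Y ω ∂P) + w * ∫ ω, Z ω ∂P := by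
  have h1 : Integrable (fun ω => u + v * Y ω) P := (integrable_const u).add (hY.const_mul v)
  rw [integral_add h1 (hZ.const_mul w), integral_add (integrable_const u) (hY.const_mul v),
    integral_const_mul, integral_const_mul]
  simp

section Moments

variable {d m : ℕ} {S : Type*} [MeasurableSpace S] {P : Measure S} [IsProbabilityMeasure P]
  {Ω : Set (EuclideanSpace ℝ (Fin d))} {σ : ℝ}
  {b : EuclideanSpace ℝ (Fin m) → EuclideanSpace ℝ (Fin m)} {T : ℝ}
  {A B : ℝ → EuclideanSpace ℝ (Fin d) → EuclideanSpace ℝ (Fin m) → EuclideanSpace ℝ (Fin d)}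
  {U₀ : EuclideanSpace ℝ (Fin d) → EuclideanSpace ℝ (Fin m) → EuclideanSpace ℝ (Fin d)}
  {V : ℝ → EuclideanSpace ℝ (Fin d) → EuclideanSpace ℝ (Fin m) → EuclideanSpace ℝ (Fin d)}
  {W : ℝ≥0 → S → EuclideanSpace ℝ (Fin m)}

/-- The constant in the moment bounds for the second component of a characteristic. -/
noncomputable def momentConst (m : ℕ) (σ K T : ℝ) : ℝ :=
  (1 + Real.sqrt (2 * σ) * (1 + m * T)) * (1 + K * Real.exp (K * T) * T)

/-- Integrable majorants built from the noise alone replace moments of `p`, so joint measurability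
of `p` is never needed. The weight `η` carries the time-dependent error `φ (t - s)` of the
uniqueness argument. -/
lemma exists_integrable_bounds_p (hW : IsBrownianMotion W P) {β t : ℝ} (hβ : 0 ≤ β)
    (hb : ∀ p p', ‖b p - b p'‖ ≤ β * ‖p - p'‖) (ht : 0 ≤ t) (htT : t ≤ T)
    {x : EuclideanSpace ℝ (Fin d)} {q : EuclideanSpace ℝ (Fin m)}
    {X : ℝ → S → EuclideanSpace ℝ (Fin d)} {p : ℝ → S → EuclideanSpace ℝ (Fin m)}
    (hP : ∀ᵐ ω ∂P, IsPath Ω b B t x q (fun s => Real.sqrt (2 * σ) • W s.toNNReal ω)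
        (fun s => X s ω) (fun s => p s ω)) {η : ℝ → ℝ} (hη : Continuous η)
    (hη0 : ∀ s ∈ Icc 0 t, 0 ≤ η s) :
    (∃ Y : S → ℝ, Integrable Y P ∧
      (∀ᵐ ω ∂P, ∫ s in (0 : ℝ)..t, η s * (1 + ‖p s ω‖) ≤ Y ω) ∧
      ∫ ω, Y ω ∂P ≤ momentConst m σ (β + ‖b 0‖) T * (1 + ‖q‖) * ∫ s in (0 : ℝ)..t, η s) ∧
    (∃ Y : S → ℝ, Integrable Y P ∧ (∀ᵐ ω ∂P, 1 + ‖p t ω‖ ≤ Y ω) ∧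
      ∫ ω, Y ω ∂P ≤ momentConst m σ (β + ‖b 0‖) T * (1 + ‖q‖)) := by
  have hT : 0 ≤ T := ht.trans htT
  set c := Real.sqrt (2 * σ) with hc
  have hc0 : 0 ≤ c := Real.sqrt_nonneg _
  set K := β + ‖b 0‖ with hK
  have hK0 : 0 ≤ K := by positivity
  set k := K * Real.exp (K * T) with hk
  have hk0 : 0 ≤ k := by positivity
  have hm0 : (0 : ℝ) ≤ 1 + m * T := by positivity
  obtain ⟨Y, hYi, hY, hYE⟩ := hW.exists_integrable_weighted ht htT hη hη0
  obtain ⟨Z, hZi, hZ, hZE⟩ := hW.exists_integrable_weighted ht htT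
    (η := fun _ => (1 : ℝ)) continuous_const (fun _ _ => zero_le_one)
  simp only [one_mul, intervalIntegral.integral_const, sub_zero, smul_eq_mul, mul_one] at hZ hZE
  have hη1 : 0 ≤ ∫ s in (0 : ℝ)..t, η s := intervalIntegral.integral_nonneg ht hη0
  have hZE' : ∫ ω, Z ω ∂P ≤ (1 + m * T) * T := hZE.trans (by gcongr)
  have hpath : ∀ᵐ ω ∂P, (ContinuousOn (fun s => p s ω) (Icc 0 t)) ∧
      ∀ s ∈ Icc 0 t, 1 + ‖p s ω‖ ≤ (1 + ‖q‖ + c * ‖W s.toNNReal ω‖) +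
        k * ((1 + ‖q‖) * T + c * Z ω) := by
    filter_upwards [hP, hW.ae_continuousOn_noise σ, hZ, hW.ae_continuous] with ω H hw hZω hWc
    have hwt := hw t
    refine ⟨H.continuousOn_p ht hwt, fun s hs => ?_⟩
    have h1 := H.one_add_norm_p_le hβ hb ht hwt s hs
    have hWi : IntervalIntegrable (fun s : ℝ => ‖W s.toNNReal ω‖) volume 0 t :=
      ((hWc.comp continuous_real_toNNReal).norm).intervalIntegrable _ _
    have h2 : ∫ r in (0 : ℝ)..t, (1 + ‖q‖ + ‖c • W r.toNNReal ω‖) =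
        t * (1 + ‖q‖) + c * Z ω := by
      simp only [norm_smul, Real.norm_of_nonneg hc0]
      rw [intervalIntegral.integral_add (by simp) (hWi.const_mul c),
        intervalIntegral.integral_const_mul, hZω]
      simp only [intervalIntegral.integral_const, sub_zero, smul_eq_mul]
    have hZ0 : 0 ≤ Z ω := by
      rw [← hZω]; exact intervalIntegral.integral_nonneg ht fun _ _ => norm_nonneg _
    rw [h2] at h1
    simp only [← hc, norm_smul, Real.norm_of_nonneg hc0] at h1
    refine h1.trans ?_
    rw [hk, mul_comm (1 + ‖q‖) T]
    gcongr
  have hfin : ∀ y : ℝ, 0 ≤ y → (1 + ‖q‖) * y + c * ((1 + m * T) * y) +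
      k * ((1 + ‖q‖) * T + c * ((1 + m * T) * T)) * y ≤
      momentConst m σ K T * (1 + ‖q‖) * y := by
    intro y hy
    have h1 : momentConst m σ K T * (1 + ‖q‖) * y - ((1 + ‖q‖) * y + c * ((1 + m * T) * y) +
      k * ((1 + ‖q‖) * T + c * ((1 + m * T) * T)) * y) =
        (1 + k * T) * c * (1 + m * T) * ‖q‖ * y := by
      rw [momentConst, ← hc, ← hk]; ring
    have : 0 ≤ (1 + k * T) * c * (1 + m * T) * ‖q‖ * y := by positivity
    linarith
  constructor
  · set J := ∫ s in (0 : ℝ)..t, η s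
    refine ⟨_, integrable_affine hYi hZi ((1 + ‖q‖) * J + k * ((1 + ‖q‖) * T) * J) c (k * c * J),
      ?_, ?_⟩
    · filter_upwards [hpath, hY, hW.ae_continuous] with ω h1 h2 hWc
      have hWi : Continuous fun s : ℝ => ‖W s.toNNReal ω‖ :=
        (hWc.comp continuous_real_toNNReal).norm
      calc ∫ s in (0 : ℝ)..t, η s * (1 + ‖p s ω‖)
          ≤ ∫ s in (0 : ℝ)..t, ((1 + ‖q‖) * η s + c * (η s * ‖W s.toNNReal ω‖) +
              k * ((1 + ‖q‖) * T + c * Z ω) * η s) := by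
            refine intervalIntegral.integral_mono_on ht
              ((hη.continuousOn.mul (continuousOn_const.add h1.1.norm)).intervalIntegrable_zero ht)
              (Continuous.intervalIntegrable (by fun_prop) _ _) fun s hs => ?_
            have := mul_le_mul_of_nonneg_left (h1.2 s hs) (hη0 s hs)
            linarith
        _ = (1 + ‖q‖) * J + c * Y ω + k * ((1 + ‖q‖) * T + c * Z ω) * J := by
            rw [intervalIntegral.integral_add (Continuous.intervalIntegrable (by fun_prop) _ _)
              (Continuous.intervalIntegrable (by fun_prop) _ _),
              intervalIntegral.integral_add (Continuous.intervalIntegrable (by fun_prop) _ _)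
              (Continuous.intervalIntegrable (by fun_prop) _ _),
              intervalIntegral.integral_const_mul, intervalIntegral.integral_const_mul,
              intervalIntegral.integral_const_mul, h2]
        _ = _ := by ring
    · rw [integral_affine hYi hZi]
      refine le_trans ?_ (hfin J hη1)
      calc _ ≤ (1 + ‖q‖) * J + k * ((1 + ‖q‖) * T) * J + c * ((1 + m * T) * J) +
            k * c * J * ((1 + m * T) * T) := by gcongr
        _ = _ := by ring
  · refine ⟨_, integrable_affine (hW.integrable_norm t.toNNReal) hZi
      ((1 + ‖q‖) + k * ((1 + ‖q‖) * T)) c (k * c), ?_, ?_⟩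
    · filter_upwards [hpath] with ω h1
      exact (h1.2 t ⟨ht, le_rfl⟩).trans (le_of_eq (by ring))
    · rw [integral_affine (hW.integrable_norm t.toNNReal) hZi]
      have h2 : ∫ ω, ‖W t.toNNReal ω‖ ∂P ≤ 1 + m * T := by
        refine (hW.integral_norm_le _).trans ?_
        rw [Real.coe_toNNReal _ ht]
        gcongr
      have h3 := hfin 1 zero_le_one
      simp only [mul_one] at h3
      refine le_trans ?_ h3
      calc _ ≤ (1 + ‖q‖) + k * ((1 + ‖q‖) * T) + c * (1 + m * T) +
            k * c * ((1 + m * T) * T) := by gcongr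
        _ = _ := by ring

lemma momentConst_nonneg {m : ℕ} {σ K T : ℝ} (hK : 0 ≤ K) (hT : 0 ≤ T) :
    0 ≤ momentConst m σ K T := by
  unfold momentConst; positivity

/-- A Feynman–Kac representation grows at most linearly in its last variable. -/
lemma IsFeynmanKac.exists_linear_growth (hΩb : Bornology.IsBounded Ω)
    (hFK : IsFeynmanKac P Ω σ b T A B U₀ V)
    (hW : IsBrownianMotion W P) {α a c k β : ℝ} (ha : 0 ≤ a) (hc : 0 ≤ c) (hk : 0 ≤ k)
    (hβ : 0 ≤ β) (hα : α ∈ Ico 0 T) (hA : LipOn Ω α a c A)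
    (hb : ∀ p p', ‖b p - b p'‖ ≤ β * ‖p - p'‖)
    (hU₀ : ∀ x ∈ Ω, ∀ x' ∈ Ω, ∀ p p', ‖U₀ x p - U₀ x' p'‖ ≤ k * (‖x - x'‖ + ‖p - p'‖)) :
    ∃ H, 0 ≤ H ∧ ∀ t ∈ Icc 0 α, ∀ x ∈ Ω, ∀ q, ‖V t x q‖ ≤ H * (1 + ‖q‖) := by
  rcases Ω.eq_empty_or_nonempty with rfl | ⟨x₀, hx₀⟩
  · exact ⟨0, le_rfl, by simp⟩
  obtain ⟨R, hR0, hR⟩ : ∃ R, 0 ≤ R ∧ ∀ x ∈ Ω, ‖x - x₀‖ ≤ R :=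
    ⟨Metric.diam Ω, Metric.diam_nonneg, fun x hx => by
      rw [← dist_eq_norm]; exact Metric.dist_le_diam_of_mem hΩb hx hx₀⟩
  have hα0 := hα.1
  -- No bound on `A` uniform in time is available, so `A` is compared with its values at the fixed
  -- state `(x₀, 0)`, which are integrable in time. Boundedness of `Ω` controls the distance of `X`
  -- to `x₀`.
  have hγ := hFK.intervalIntegrable_time hW hα hA hx₀ 0
  set I := ∫ τ in (0 : ℝ)..α, ‖A τ x₀ 0‖
  have hI0 : 0 ≤ I := intervalIntegral.integral_nonneg hα0 fun _ _ => norm_nonneg _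
  set Cm := momentConst m σ (β + ‖b 0‖) α
  have hCm : 0 ≤ Cm := momentConst_nonneg (by positivity) hα0
  refine ⟨I + ‖U₀ x₀ 0‖ + (a * R + c) * (Cm * α) + k * (R + 1) * Cm, by positivity,
    fun t ht x hx q => ?_⟩
  obtain ⟨X, p, hch, hi, hint, hV⟩ := hFK t ⟨ht.1, ht.2.trans_lt hα.2⟩ x hx q W hW
  obtain ⟨⟨Y, hYi, hY, hYE⟩, ⟨Z, hZi, hZ, hZE⟩⟩ := exists_integrable_bounds_p hW hβ hb ht.1 ht.2
    hch.isPath (η := fun _ => 1) continuous_const (fun _ _ => zero_le_one)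
  simp only [one_mul, intervalIntegral.integral_const, sub_zero, smul_eq_mul, mul_one] at hY hYE
  have hbound : ∀ᵐ ω ∂P, ‖(∫ s in (0 : ℝ)..t, A (t - s) (X s ω) (p s ω)) + U₀ (X t ω) (p t ω)‖ ≤
      I + ‖U₀ x₀ 0‖ + (a * R + c) * Y ω + k * (R + 1) * Z ω := by
    filter_upwards [hch.isPath, hY, hZ, hW.ae_continuousOn_noise σ] with ω H h1 h2 hw
    have hpc := H.continuousOn_p ht.1 (hw t)
    have hpi : IntervalIntegrable (fun s => 1 + ‖p s ω‖) volume 0 t :=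
      (continuousOn_const.add hpc.norm).intervalIntegrable_zero ht.1
    have hγt : IntervalIntegrable (fun s => A (t - s) x₀ 0) volume 0 t := by
      have := (intervalIntegrable_sub_of_mem hγ ⟨le_rfl, hα0⟩ ht).comp_sub_left t
      simp only [sub_self, sub_zero] at this
      exact this.symm
    have e1 : ∫ s in (0 : ℝ)..t, ‖A (t - s) x₀ 0‖ ≤ I := by
      rw [intervalIntegral.integral_comp_sub_left (fun τ => ‖A τ x₀ 0‖) t]
      simp only [sub_self, sub_zero]
      exact intervalIntegral.integral_mono_interval le_rfl ht.1 ht.2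
        (.of_forall fun _ => norm_nonneg _) hγ.norm
    have e2 : ‖∫ s in (0 : ℝ)..t, A (t - s) (X s ω) (p s ω)‖ ≤
        ∫ s in (0 : ℝ)..t, (‖A (t - s) x₀ 0‖ + (a * R + c) * (1 + ‖p s ω‖)) := by
      refine intervalIntegral.norm_integral_le_of_norm_le ht.1 (.of_forall fun s hs => ?_)
        (hγt.norm.add (hpi.const_mul _))
      have hs' : s ∈ Icc 0 t := ⟨hs.1.le, hs.2⟩
      have h3 := hA (t - s) ⟨by linarith [hs.2], by linarith [hs.1, ht.2]⟩ _ (H.mem s hs') _ hx₀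
        (p s ω) 0
      have h4 : ‖A (t - s) (X s ω) (p s ω)‖ ≤
          ‖A (t - s) (X s ω) (p s ω) - A (t - s) x₀ 0‖ + ‖A (t - s) x₀ 0‖ := by
        simpa using norm_add_le (A (t - s) (X s ω) (p s ω) - A (t - s) x₀ 0) (A (t - s) x₀ 0)
      have h5 := mul_le_mul_of_nonneg_left (hR _ (H.mem s hs')) ha
      have h6 : 0 ≤ a * R * ‖p s ω‖ := by positivity
      rw [sub_zero] at h3
      linarith
    rw [intervalIntegral.integral_add hγt.norm (hpi.const_mul _),
      intervalIntegral.integral_const_mul] at e2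
    have tt : t ∈ Icc 0 t := ⟨ht.1, le_rfl⟩
    have e3 := hU₀ _ (H.mem t tt) _ hx₀ (p t ω) 0
    have e4 : ‖U₀ (X t ω) (p t ω)‖ ≤ ‖U₀ (X t ω) (p t ω) - U₀ x₀ 0‖ + ‖U₀ x₀ 0‖ := by
      simpa using norm_add_le (U₀ (X t ω) (p t ω) - U₀ x₀ 0) (U₀ x₀ 0)
    have e5 : k * (‖X t ω - x₀‖ + ‖p t ω - 0‖) ≤ k * (R + 1) * (1 + ‖p t ω‖) := by
      rw [mul_assoc]
      refine mul_le_mul_of_nonneg_left ?_ hk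
      rw [sub_zero]
      have := hR _ (H.mem t tt)
      have h6 : 0 ≤ R * ‖p t ω‖ := by positivity
      linarith
    have e6 : k * (R + 1) * (1 + ‖p t ω‖) ≤ k * (R + 1) * Z ω := by gcongr
    have e7 : (a * R + c) * ∫ s in (0 : ℝ)..t, (1 + ‖p s ω‖) ≤ (a * R + c) * Y ω := by gcongr
    refine (norm_add_le _ _).trans ?_
    linarith
  rw [hV]
  refine (norm_integral_le_of_norm_le (integrable_affine hYi hZi _ _ _) hbound).trans ?_
  rw [integral_affine hYi hZi]
  have hYE' : ∫ ω, Y ω ∂P ≤ Cm * (1 + ‖q‖) * α := hYE.trans (by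
    have := ht.2
    gcongr)
  have hU : 0 ≤ (I + ‖U₀ x₀ 0‖) * ‖q‖ := by positivity
  calc I + ‖U₀ x₀ 0‖ + (a * R + c) * (∫ ω, Y ω ∂P) + k * (R + 1) * ∫ ω, Z ω ∂P
      ≤ I + ‖U₀ x₀ 0‖ + (a * R + c) * (Cm * (1 + ‖q‖) * α) + k * (R + 1) * (Cm * (1 + ‖q‖)) := by
        gcongr
    _ ≤ _ := by linarith

end Moments

section Uniqueness

variable {d m : ℕ} {S : Type*} [MeasurableSpace S] {P : Measure S} [IsProbabilityMeasure P]
  {Ω : Set (EuclideanSpace ℝ (Fin d))} {σ : ℝ}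
  {b : EuclideanSpace ℝ (Fin m) → EuclideanSpace ℝ (Fin m)} {T : ℝ}
  {F G : EuclideanSpace ℝ (Fin d) → EuclideanSpace ℝ (Fin m) → EuclideanSpace ℝ (Fin d) →
      EuclideanSpace ℝ (Fin d)}
  {U₀ : EuclideanSpace ℝ (Fin d) → EuclideanSpace ℝ (Fin m) → EuclideanSpace ℝ (Fin d)}
  {U V : ℝ → EuclideanSpace ℝ (Fin d) → EuclideanSpace ℝ (Fin m) → EuclideanSpace ℝ (Fin d)}
  {W : ℝ≥0 → S → EuclideanSpace ℝ (Fin m)}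

/-- A function of three variables is Lipschitz on `Ω` with constant `L`. -/
def LipThree (Ω : Set (EuclideanSpace ℝ (Fin d))) (L : ℝ)
    (F : EuclideanSpace ℝ (Fin d) → EuclideanSpace ℝ (Fin m) → EuclideanSpace ℝ (Fin d) →
      EuclideanSpace ℝ (Fin d)) : Prop :=
  ∀ x ∈ Ω, ∀ x' ∈ Ω, ∀ p p' u u',
    ‖F x p u - F x' p' u'‖ ≤ L * (‖x - x'‖ + ‖p - p'‖ + ‖u - u'‖)

/-- One step of the Picard-type iteration bounding the distance of two solutions. -/
lemma norm_sub_le_integral_of_norm_sub_le (hW : IsBrownianMotion W P) {L β k K α : ℝ} (hL : 0 ≤ L)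
    (hβ : 0 ≤ β) (hk : 0 ≤ k) (hK : 0 ≤ K) (hα : α ∈ Ico 0 T) (hF : LipThree Ω L F)
    (hG : LipThree Ω L G)
    (hb : ∀ p p', ‖b p - b p'‖ ≤ β * ‖p - p'‖)
    (hU₀ : ∀ x ∈ Ω, ∀ x' ∈ Ω, ∀ p p', ‖U₀ x p - U₀ x' p'‖ ≤ k * (‖x - x'‖ + ‖p - p'‖))
    (hU : IsFeynmanKac P Ω σ b T (fun t x p => G x p (U t x p)) (fun t x p => F x p (U t x p)) U₀ U)
    (hV : IsFeynmanKac P Ω σ b T (fun t x p => G x p (V t x p)) (fun t x p => F x p (V t x p)) U₀ V)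
    (hUK : ∀ t ∈ Icc 0 α, ∀ x ∈ Ω, ∀ x' ∈ Ω, ∀ p, ‖U t x p - U t x' p‖ ≤ K * ‖x - x'‖) :
    ∃ C, 0 ≤ C ∧ ∀ φ : ℝ → ℝ, Continuous φ → (∀ s ∈ Icc 0 α, 0 ≤ φ s) →
      (∀ t ∈ Icc 0 α, ∀ x ∈ Ω, ∀ q, ‖U t x q - V t x q‖ ≤ φ t * (1 + ‖q‖)) →
      ∀ t ∈ Icc 0 α, ∀ x ∈ Ω, ∀ q,
        ‖U t x q - V t x q‖ ≤ C * (∫ s in (0 : ℝ)..t, φ s) * (1 + ‖q‖) := by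
  have hα0 := hα.1
  set a := L * (1 + K) with ha
  have ha0 : 0 ≤ a := by positivity
  set Cm := momentConst m σ (β + ‖b 0‖) α
  have hCm : 0 ≤ Cm := momentConst_nonneg (by positivity) hα0
  -- The three terms come from the gap between the `X`-components in the running payoff, the gap
  -- between `U` and `V` there, and the terminal payoff.
  set C₀ := α * (a * (L * Real.exp (a * α))) + L + k * (L * Real.exp (a * α)) with hC₀
  have hC₀0 : 0 ≤ C₀ := by positivity
  refine ⟨C₀ * Cm, by positivity, fun φ hφ hφ0 hUV t ht x hx q => ?_⟩
  have htT : t ∈ Ico 0 T := ⟨ht.1, ht.2.trans_lt hα.2⟩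
  have tt : t ∈ Icc 0 t := ⟨ht.1, le_rfl⟩
  obtain ⟨X, p, hch, hi, hint, hUx⟩ := hU t htT x hx q W hW
  obtain ⟨X', p', hch', hi', hint', hVx⟩ := hV t htT x hx q W hW
  have hη0 : ∀ s ∈ Icc 0 t, 0 ≤ φ (t - s) := fun s hs =>
    hφ0 _ ⟨by linarith [hs.2], by linarith [hs.1, ht.2]⟩
  obtain ⟨⟨Y, hYi, hY, hYE⟩, -⟩ := exists_integrable_bounds_p hW hβ hb ht.1 ht.2
    hch.isPath (η := fun s => φ (t - s)) (by fun_prop) hη0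
  rw [intervalIntegral.integral_comp_sub_left φ t, sub_self, sub_zero] at hYE
  rw [hUx, hVx, ← integral_sub hint hint']
  have hbound : ∀ᵐ ω ∂P, ‖((∫ s in (0 : ℝ)..t, G (X s ω) (p s ω) (U (t - s) (X s ω) (p s ω))) +
      U₀ (X t ω) (p t ω)) - ((∫ s in (0 : ℝ)..t, G (X' s ω) (p' s ω)
        (V (t - s) (X' s ω) (p' s ω))) + U₀ (X' t ω) (p' t ω))‖ ≤ C₀ * Y ω := by
    filter_upwards [hch.isPath, hch'.isPath, hi, hi', hY, hW.ae_continuousOn_noise σ]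
      with ω H H' j j' hYω hw
    -- The second component solves an equation free of `U` and `V`, so with the same start and noise
    -- it is the same for both solutions.
    have hpp : ∀ s ∈ Icc 0 t, p s ω = p' s ω := fun s hs => by
      have := H.norm_p_sub_le hβ hb H' s hs
      rw [sub_self, norm_zero, zero_mul] at this
      exact sub_eq_zero.1 (norm_le_zero_iff.1 this)
    have hpc := H.continuousOn_p ht.1 (hw t)
    set I := ∫ s in (0 : ℝ)..t, φ (t - s) * (1 + ‖p s ω‖) with hI
    have hIi : IntervalIntegrable (fun s => φ (t - s) * (1 + ‖p s ω‖)) volume 0 t :=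
      ((hφ.comp (continuous_const.sub continuous_id)).continuousOn.mul
        (continuousOn_const.add hpc.norm)).intervalIntegrable_zero ht.1
    have hI0 : 0 ≤ I := intervalIntegral.integral_nonneg ht.1 fun s hs =>
      mul_nonneg (hη0 s hs) (by positivity)
    have hlip : ∀ F, LipThree Ω L F → ∀ s ∈ Icc 0 t,
        ‖F (X s ω) (p s ω) (U (t - s) (X s ω) (p s ω)) -
          F (X' s ω) (p' s ω) (V (t - s) (X' s ω) (p' s ω))‖ ≤
        a * ‖X s ω - X' s ω‖ + L * (φ (t - s) * (1 + ‖p s ω‖)) := by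
      intro F hF s hs
      have hts : t - s ∈ Icc 0 α := ⟨by linarith [hs.2], by linarith [hs.1, ht.2]⟩
      rw [← hpp s hs]
      refine (hF _ (H.mem s hs) _ (H'.mem s hs) _ _ _ _).trans ?_
      have h1 := hUK _ hts _ (H.mem s hs) _ (H'.mem s hs) (p s ω)
      have h2 := hUV _ hts _ (H'.mem s hs) (p s ω)
      -- Passing through `U` at `X'` uses the Lipschitz bound in `x` for `U` only, and compares `U`
      -- with `V` at a common point.
      have h3 := norm_sub_le_norm_sub_add_norm_sub (U (t - s) (X s ω) (p s ω))
        (U (t - s) (X' s ω) (p s ω)) (V (t - s) (X' s ω) (p s ω))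
      have h4 : ‖X s ω - X' s ω‖ + ‖p s ω - p s ω‖ +
          ‖U (t - s) (X s ω) (p s ω) - V (t - s) (X' s ω) (p s ω)‖ ≤
          (1 + K) * ‖X s ω - X' s ω‖ + φ (t - s) * (1 + ‖p s ω‖) := by
        rw [sub_self, norm_zero]; linarith
      refine (mul_le_mul_of_nonneg_left h4 hL).trans (le_of_eq ?_)
      rw [ha]; ring
    have hX : ∀ s ∈ Icc 0 t, ‖X s ω - X' s ω‖ ≤ L * Real.exp (a * α) * I := by
      intro s hs
      have h1 := norm_sub_le_of_integral_eq ha0 H.integrable_X H'.integrable_X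
        (hIi.const_mul L) (fun s hs => mul_nonneg hL (mul_nonneg (hη0 s hs) (by positivity)))
        H.eq_X H'.eq_X (hlip F hF) s hs
      rw [sub_self, norm_zero, zero_add, intervalIntegral.integral_const_mul, ← hI] at h1
      refine h1.trans ?_
      have h2 : Real.exp (a * s) ≤ Real.exp (a * α) :=
        Real.exp_le_exp.2 (mul_le_mul_of_nonneg_left (hs.2.trans ht.2) ha0)
      calc L * I * Real.exp (a * s) ≤ L * I * Real.exp (a * α) := by gcongr
        _ = _ := by ring
    have hD : ‖(∫ s in (0 : ℝ)..t, G (X s ω) (p s ω) (U (t - s) (X s ω) (p s ω))) -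
        ∫ s in (0 : ℝ)..t, G (X' s ω) (p' s ω) (V (t - s) (X' s ω) (p' s ω))‖ ≤
        ∫ s in (0 : ℝ)..t, (a * (L * Real.exp (a * α) * I) +
          L * (φ (t - s) * (1 + ‖p s ω‖))) := by
      rw [← intervalIntegral.integral_sub j j']
      refine intervalIntegral.norm_integral_le_of_norm_le ht.1 (.of_forall fun s hs => ?_)
        (intervalIntegrable_const.add (hIi.const_mul L))
      have hs' : s ∈ Icc 0 t := ⟨hs.1.le, hs.2⟩
      refine (hlip G hG s hs').trans ?_
      gcongr
      exact hX s hs'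
    rw [intervalIntegral.integral_add intervalIntegrable_const (hIi.const_mul L),
      intervalIntegral.integral_const, intervalIntegral.integral_const_mul, ← hI, sub_zero,
      smul_eq_mul] at hD
    have hE := hU₀ _ (H.mem t tt) _ (H'.mem t tt) (p t ω) (p' t ω)
    rw [← hpp t tt, sub_self, norm_zero, add_zero] at hE
    have hE' := hE.trans (mul_le_mul_of_nonneg_left (hX t tt) hk)
    rw [← hpp t tt, add_sub_add_comm]
    calc _ ≤ _ := norm_add_le _ _
      _ ≤ (t * (a * (L * Real.exp (a * α) * I)) + L * I) + k * (L * Real.exp (a * α) * I) :=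
          add_le_add hD hE'
      _ ≤ (α * (a * (L * Real.exp (a * α) * I)) + L * I) + k * (L * Real.exp (a * α) * I) := by
          have := ht.2
          gcongr
      _ = C₀ * I := by rw [hC₀]; ring
      _ ≤ C₀ * Y ω := by gcongr
  refine (norm_integral_le_of_norm_le (hYi.const_mul C₀) hbound).trans ?_
  rw [integral_const_mul]
  refine (mul_le_mul_of_nonneg_left hYE hC₀0).trans (le_of_eq ?_)
  ring

/-- Two Feynman–Kac solutions of the nonlinear system coincide. -/
lemma feynmanKac_unique (hΩb : Bornology.IsBounded Ω) (hW : IsBrownianMotion W P)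
    {L β k K α : ℝ} (hL : 0 ≤ L)
    (hβ : 0 ≤ β) (hk : 0 ≤ k) (hK : 0 ≤ K) (hα : α ∈ Ico 0 T) (hF : LipThree Ω L F)
    (hG : LipThree Ω L G)
    (hb : ∀ p p', ‖b p - b p'‖ ≤ β * ‖p - p'‖)
    (hU₀ : ∀ x ∈ Ω, ∀ x' ∈ Ω, ∀ p p', ‖U₀ x p - U₀ x' p'‖ ≤ k * (‖x - x'‖ + ‖p - p'‖))
    (hU : IsFeynmanKac P Ω σ b T (fun t x p => G x p (U t x p)) (fun t x p => F x p (U t x p)) U₀ U)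
    (hV : IsFeynmanKac P Ω σ b T (fun t x p => G x p (V t x p)) (fun t x p => F x p (V t x p)) U₀ V)
    (hUK : LipOn Ω α K K U) (hVK : LipOn Ω α K K V) :
    ∀ t ∈ Icc 0 α, ∀ x ∈ Ω, ∀ q, U t x q = V t x q := by
  have hlip : ∀ U, LipOn Ω α K K U → LipOn Ω α (L * (1 + K)) (L * (1 + K))
      (fun t x p => G x p (U t x p)) := by
    intro U hU τ hτ x hx x' hx' p p'
    refine (hG _ hx _ hx' _ _ _ _).trans ?_
    have := mul_le_mul_of_nonneg_left (hU τ hτ x hx x' hx' p p') hL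
    linarith
  obtain ⟨H, hH0, hH⟩ := hU.exists_linear_growth hΩb hW (by positivity) (by positivity) hk hβ hα
    (hlip U hUK) hb hU₀
  obtain ⟨H', hH0', hH'⟩ := hV.exists_linear_growth hΩb hW (by positivity) (by positivity) hk hβ hα
    (hlip V hVK) hb hU₀
  obtain ⟨C, hC, hstep⟩ := norm_sub_le_integral_of_norm_sub_le hW hL hβ hk hK hα hF hG hb hU₀ hU hV
    (fun t ht x hx x' hx' p => by simpa using hUK t ht x hx x' hx' p p)
  -- Linear growth of both solutions starts the iteration; each step integrates the previous bound
  -- in time, which produces the factorial.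
  have hiter : ∀ n : ℕ, ∀ t ∈ Icc 0 α, ∀ x ∈ Ω, ∀ q,
      ‖U t x q - V t x q‖ ≤ ((H + H') * ((C * t) ^ n / n.factorial)) * (1 + ‖q‖) := by
    intro n
    induction n with
    | zero =>
      intro t ht x hx q
      refine (norm_sub_le _ _).trans ?_
      simp only [pow_zero, Nat.factorial_zero, Nat.cast_one, div_one, mul_one]
      linarith [hH t ht x hx q, hH' t ht x hx q]
    | succ n ih =>
      intro t ht x hx q
      have h1 := hstep (fun s => (H + H') * ((C * s) ^ n / n.factorial)) (by fun_prop)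
        (fun s hs => by have := hs.1; positivity) ih t ht x hx q
      refine h1.trans (le_of_eq ?_)
      congr 1
      simp_rw [mul_pow, mul_div_right_comm, ← mul_assoc]
      rw [intervalIntegral.integral_const_mul, integral_pow, Nat.factorial_succ]
      have : (n.factorial : ℝ) ≠ 0 := by positivity
      push_cast
      field_simp
      ring
  intro t ht x hx q
  have hlim : Filter.Tendsto (fun n : ℕ => ((H + H') * ((C * t) ^ n / n.factorial)) * (1 + ‖q‖))
      Filter.atTop (nhds (((H + H') * 0) * (1 + ‖q‖))) :=
    ((FloorSemiring.tendsto_pow_div_factorial_atTop (C * t)).const_mul _).mul_const _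
  have := ge_of_tendsto' hlim fun n => hiter n t ht x hx q
  rw [mul_zero, zero_mul] at this
  exact sub_eq_zero.1 (norm_le_zero_iff.1 this)

end Uniqueness

/-! ### Lipschitz seminorms -/

section Seminorms

variable {d m : ℕ} {Ω : Set (EuclideanSpace ℝ (Fin d))}
  {f : EuclideanSpace ℝ (Fin d) → EuclideanSpace ℝ (Fin m) → EuclideanSpace ℝ (Fin d)}

lemma edist_div_edist_le {E F : Type*} [NormedAddCommGroup E] [NormedAddCommGroup F] {x y : E}
    {u v : F} {M : ℝ} (hM : 0 ≤ M) (hxy : x ≠ y) :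
    edist u v / edist x y ≤ ENNReal.ofReal M ↔ ‖u - v‖ ≤ M * ‖x - y‖ := by
  have h0 : 0 < ‖x - y‖ := norm_pos_iff.2 (sub_ne_zero.2 hxy)
  rw [edist_dist, edist_dist, dist_eq_norm, dist_eq_norm, ← ENNReal.ofReal_div_of_pos h0]
  rw [ENNReal.ofReal_le_ofReal_iff hM, div_le_iff₀ h0]

lemma lipX_le_iff {M : ℝ} (hM : 0 ≤ M) : lipX Ω f ≤ ENNReal.ofReal M ↔
    ∀ x ∈ Ω, ∀ y ∈ Ω, ∀ p, ‖f x p - f y p‖ ≤ M * ‖x - y‖ := by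
  simp only [lipX, iSup_le_iff]
  refine forall₄_congr fun x _ y _ => ⟨fun h p => ?_, fun h hxy p => ?_⟩
  · rcases eq_or_ne x y with rfl | hxy
    · simp
    · exact (edist_div_edist_le hM hxy).1 (h hxy p)
  · exact (edist_div_edist_le hM hxy).2 (h p)

lemma lipP_le_iff {N : ℝ} (hN : 0 ≤ N) : lipP Ω f ≤ ENNReal.ofReal N ↔
    ∀ x ∈ Ω, ∀ p q, ‖f x p - f x q‖ ≤ N * ‖p - q‖ := by
  simp only [lipP, iSup_le_iff]
  refine forall₄_congr fun x _ p q => ⟨fun h => ?_, fun h hpq => ?_⟩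
  · rcases eq_or_ne p q with rfl | hpq
    · simp
    · exact (edist_div_edist_le hN hpq).1 (h hpq)
  · exact (edist_div_edist_le hN hpq).2 h

end Seminorms

/-! ### Growth in time of the Lipschitz constant in `p` -/

section Growth

variable {d m : ℕ} {S : Type*} [MeasurableSpace S] {P : Measure S} [IsProbabilityMeasure P]
  {Ω : Set (EuclideanSpace ℝ (Fin d))} {σ : ℝ}
  {b : EuclideanSpace ℝ (Fin m) → EuclideanSpace ℝ (Fin m)} {T : ℝ}
  {F G : EuclideanSpace ℝ (Fin d) → EuclideanSpace ℝ (Fin m) → EuclideanSpace ℝ (Fin d) →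
      EuclideanSpace ℝ (Fin d)}
  {U₀ : EuclideanSpace ℝ (Fin d) → EuclideanSpace ℝ (Fin m) → EuclideanSpace ℝ (Fin d)}
  {U : ℝ → EuclideanSpace ℝ (Fin d) → EuclideanSpace ℝ (Fin m) → EuclideanSpace ℝ (Fin d)}
  {W : ℝ≥0 → S → EuclideanSpace ℝ (Fin m)}

/-- `U(s)` is Lipschitz in `p` with constant `N`, for `s ∈ [0, t]`. -/
def LipLast (Ω : Set (EuclideanSpace ℝ (Fin d)))
    (U : ℝ → EuclideanSpace ℝ (Fin d) → EuclideanSpace ℝ (Fin m) → EuclideanSpace ℝ (Fin d))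
    (t N : ℝ) : Prop :=
  ∀ s ∈ Icc 0 t, ∀ x ∈ Ω, ∀ p q, ‖U s x p - U s x q‖ ≤ N * ‖p - q‖

/-- The running supremum of `‖D_p U(s)‖_∞`. -/
noncomputable def runningLipP (Ω : Set (EuclideanSpace ℝ (Fin d)))
    (U : ℝ → EuclideanSpace ℝ (Fin d) → EuclideanSpace ℝ (Fin m) → EuclideanSpace ℝ (Fin d))
    (t : ℝ) : ℝ :=
  (⨆ s ∈ Icc 0 t, lipP Ω (U s)).toReal

lemma LipLast.iSup_le {t N : ℝ} (hN : 0 ≤ N) (h : LipLast Ω U t N) :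
    (⨆ s ∈ Icc 0 t, lipP Ω (U s)) ≤ ENNReal.ofReal N :=
  iSup₂_le fun s hs => (lipP_le_iff hN).2 (h s hs)

lemma LipLast.runningLipP_le {t N : ℝ} (hN : 0 ≤ N) (h : LipLast Ω U t N) :
    runningLipP Ω U t ≤ N :=
  ENNReal.toReal_le_of_le_ofReal hN (h.iSup_le hN)

/-- The a priori constant `N` serves only to make the supremum finite, so that `toReal` loses
nothing and the supremum is itself admissible. -/
lemma LipLast.lipLast_runningLipP {t N : ℝ} (hN : 0 ≤ N) (h : LipLast Ω U t N) :
    LipLast Ω U t (runningLipP Ω U t) := by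
  intro s hs
  refine (lipP_le_iff ENNReal.toReal_nonneg).1 ?_
  rw [ENNReal.ofReal_toReal (ne_top_of_le_ne_top ENNReal.ofReal_ne_top (h.iSup_le hN))]
  exact le_iSup₂ (f := fun s _ => lipP Ω (U s)) s hs

lemma LipLast.mono {t t' N N' : ℝ} (h : LipLast Ω U t N) (ht : t' ≤ t) (hN : N ≤ N') :
    LipLast Ω U t' N' := fun s hs x hx p q =>
  (h s ⟨hs.1, hs.2.trans ht⟩ x hx p q).trans (by gcongr)

/-- Growth of the Lipschitz constant in `p` over a small time step. -/
lemma one_add_runningLipP_step (hΩ : IsOpen Ω) (hW : IsBrownianMotion W P)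
    {L β k M N t h : ℝ} (hL : 0 ≤ L) (hβ : 0 ≤ β) (hk : 0 ≤ k) (hM : 0 ≤ M) (hN : 0 ≤ N)
    (hF : LipThree Ω L F) (hG : LipThree Ω L G)
    (hb : ∀ p p', ‖b p - b p'‖ ≤ β * ‖p - p'‖)
    (hU₀ : ∀ x ∈ Ω, ∀ x' ∈ Ω, ∀ p p', ‖U₀ x p - U₀ x' p'‖ ≤ k * (‖x - x'‖ + ‖p - p'‖))
    (hU : IsFeynmanKac P Ω σ b T (fun t x p => G x p (U t x p)) (fun t x p => F x p (U t x p)) U₀ U)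
    (ht : 0 ≤ t) (hh : 0 ≤ h) (hT : t + h < T)
    (hUM : ∀ s ∈ Icc 0 (t + h), ∀ x ∈ Ω, ∀ x' ∈ Ω, ∀ p, ‖U s x p - U s x' p‖ ≤ M * ‖x - x'‖)
    (hUN : LipLast Ω U (t + h) N)
    (h1 : (L * (1 + M) + β) * h ≤ 1 / 2) (h2 : 2 * L * (2 + M) * h ≤ 1 / 2) :
    1 + runningLipP Ω U (t + h) ≤
      Real.exp ((β + 4 * L * (2 + M)) * h) * (1 + runningLipP Ω U t) := by
  set N₁ := runningLipP Ω U (t + h) with hN₁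
  set N₀ := runningLipP Ω U t with hN₀
  have hN₁0 : 0 ≤ N₁ := ENNReal.toReal_nonneg
  have hN₀0 : 0 ≤ N₀ := ENNReal.toReal_nonneg
  have hl1 : LipLast Ω U (t + h) N₁ := hUN.lipLast_runningLipP hN
  have hl0 : LipLast Ω U t N₀ := (hUN.mono (by linarith) le_rfl).lipLast_runningLipP hN
  set a := L * (1 + M) with ha
  set c := L * (1 + N₁) with hc
  have ha0 : 0 ≤ a := by positivity
  have hc0 : 0 ≤ c := by positivity
  have hUlip : ∀ s ∈ Icc 0 (t + h), ∀ N, (∀ x ∈ Ω, ∀ p q, ‖U s x p - U s x q‖ ≤ N * ‖p - q‖) →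
      ∀ x ∈ Ω, ∀ x' ∈ Ω, ∀ p p', ‖U s x p - U s x' p'‖ ≤ M * ‖x - x'‖ + N * ‖p - p'‖ := by
    intro s hs N hN x hx x' hx' p p'
    refine (norm_sub_le_norm_sub_add_norm_sub _ (U s x' p) _).trans ?_
    exact add_le_add (hUM s hs x hx x' hx' p) (hN x' hx' p p')
  have hlip : ∀ F, LipThree Ω L F → LipOn Ω (t + h) a c (fun t x p => F x p (U t x p)) := by
    intro F hF τ hτ x hx x' hx' p p'
    refine (hF _ hx _ hx' _ _ _ _).trans ?_
    have := mul_le_mul_of_nonneg_left (hUlip τ hτ N₁ (hl1 τ hτ) x hx x' hx' p p') hL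
    rw [ha, hc]
    linarith
  set Θ := 2 * L * (2 + M) with hΘ
  have hΘ0 : 0 ≤ Θ := by positivity
  -- The exponent is at most `1 / 2` by the first smallness condition, and `exp (1 / 2) ≤ 2`.
  have hexp : Real.exp (β * h) * Real.exp (a * h) ≤ 2 := by
    rw [← Real.exp_add]
    have e1 : Real.exp (β * h + a * h) ≤ Real.exp (1 / 2) := Real.exp_le_exp.2 (by linarith)
    have e2 := Real.add_one_le_exp (-(1 / 2) : ℝ)
    have e3 : Real.exp (1 / 2) * Real.exp (-(1 / 2)) = 1 := by rw [← Real.exp_add]; simp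
    nlinarith [Real.exp_pos (1 / 2)]
  have hah : a * h ≤ 1 := by nlinarith
  -- The estimate is implicit: the coefficients on the step have constant `c = L * (1 + N₁)` in `p`,
  -- so `N₁` also stands on the right, but with the small factor `h * Θ`.
  have key : LipLast Ω U (t + h) (N₀ * Real.exp (β * h) + h * Θ * (1 + N₁)) := by
    intro s hs x hx q q'
    rcases le_or_gt s t with hst | hst
    · refine (hl0 s ⟨hs.1, hst⟩ x hx q q').trans ?_
      have : 1 ≤ Real.exp (β * h) := Real.one_le_exp (by positivity)
      have h3 : 0 ≤ h * Θ * (1 + N₁) := by positivity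
      gcongr
      nlinarith
    · obtain ⟨h', rfl⟩ : ∃ h', s = t + h' := ⟨s - t, by ring⟩
      have hh'0 : 0 ≤ h' := by linarith
      have hh' : h' ≤ h := by linarith [hs.2]
      have ht' : t ∈ Icc 0 (t + h) := ⟨ht, by linarith⟩
      refine (hU.norm_sub_le_step hΩ hW ha0 hc0 hk hβ hM hN₀0 ht hh'0 (by linarith)
        ((hlip G hG).mono (by linarith)) ((hlip F hF).mono (by linarith)) hb hU₀
        (hUlip t ht' N₀ (hl0 t ⟨ht, le_rfl⟩)) hx q q').trans ?_
      set D := ‖q - q'‖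
      have hD : 0 ≤ D := norm_nonneg _
      have hea : 1 ≤ Real.exp (a * h) := Real.one_le_exp (by positivity)
      have hβh : Real.exp (β * h') ≤ Real.exp (β * h) := Real.exp_le_exp.2 (by gcongr)
      set eβ := Real.exp (β * h) with heβ
      have heβ0 : 0 < eβ := Real.exp_pos _
      have hce : c * (D * eβ) ≤ c * (D * eβ) * Real.exp (a * h) :=
        le_mul_of_one_le_right (by positivity) hea
      calc _ ≤ h * (a * (h * (c * (D * eβ)) * Real.exp (a * h)) + c * (D * eβ)) +
            (M * (h * (c * (D * eβ)) * Real.exp (a * h)) + N₀ * (D * eβ)) := by gcongr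
        _ ≤ h * (a * (h * (c * (D * eβ)) * Real.exp (a * h)) +
              c * (D * eβ) * Real.exp (a * h)) +
            (M * (h * (c * (D * eβ)) * Real.exp (a * h)) + N₀ * (D * eβ)) := by
            linarith [mul_le_mul_of_nonneg_left hce hh]
        _ = (N₀ * eβ + h * c * (a * h + 1 + M) * (eβ * Real.exp (a * h))) * D := by ring
        _ ≤ (N₀ * eβ + h * c * (1 + 1 + M) * 2) * D := by gcongr
        _ = _ := by rw [hc, hΘ]; ring
  have h3 : N₁ ≤ N₀ * Real.exp (β * h) + h * Θ * (1 + N₁) :=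
    key.runningLipP_le (by positivity)
  have h4 : 1 ≤ Real.exp (β * h) := Real.one_le_exp (by positivity)
  have h5 : (1 + N₁) * (1 - Θ * h) ≤ Real.exp (β * h) * (1 + N₀) := by nlinarith
  -- For `0 ≤ y ≤ 1 / 2` one has `(1 - y) * (1 + 2 * y) ≥ 1`. Absorbing `N₁` thus doubles the rate,
  -- `2 * Θ = 4 * L * (2 + M)`.
  have h6 : 1 ≤ (1 - Θ * h) * Real.exp (2 * (Θ * h)) := by
    have e1 := Real.add_one_le_exp (2 * (Θ * h))
    have e2 : 0 ≤ Θ * h := by positivity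
    nlinarith
  calc 1 + N₁ ≤ (1 + N₁) * ((1 - Θ * h) * Real.exp (2 * (Θ * h))) :=
        le_mul_of_one_le_right (by positivity) h6
    _ = ((1 + N₁) * (1 - Θ * h)) * Real.exp (2 * (Θ * h)) := by ring
    _ ≤ (Real.exp (β * h) * (1 + N₀)) * Real.exp (2 * (Θ * h)) := by gcongr
    _ = Real.exp (β * h) * Real.exp (2 * (Θ * h)) * (1 + N₀) := by ring
    _ = _ := by
        rw [← Real.exp_add]
        congr 2
        rw [hΘ]; ring

/-- Growth of the Lipschitz constant in `p` over `[t', t]`: exponential, with a rate affine in the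
Lipschitz constant in `x`. -/
lemma one_add_runningLipP_le (hΩ : IsOpen Ω) (hW : IsBrownianMotion W P)
    {L β k M N t' t : ℝ} (hL : 0 ≤ L) (hβ : 0 ≤ β) (hk : 0 ≤ k) (hM : 0 ≤ M) (hN : 0 ≤ N)
    (hF : LipThree Ω L F) (hG : LipThree Ω L G)
    (hb : ∀ p p', ‖b p - b p'‖ ≤ β * ‖p - p'‖)
    (hU₀ : ∀ x ∈ Ω, ∀ x' ∈ Ω, ∀ p p', ‖U₀ x p - U₀ x' p'‖ ≤ k * (‖x - x'‖ + ‖p - p'‖))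
    (hU : IsFeynmanKac P Ω σ b T (fun t x p => G x p (U t x p)) (fun t x p => F x p (U t x p)) U₀ U)
    (ht' : 0 ≤ t') (htt : t' ≤ t) (hT : t < T)
    (hUM : ∀ s ∈ Icc 0 t, ∀ x ∈ Ω, ∀ x' ∈ Ω, ∀ p, ‖U s x p - U s x' p‖ ≤ M * ‖x - x'‖)
    (hUN : LipLast Ω U t N) :
    1 + runningLipP Ω U t ≤
      Real.exp ((β + 4 * L * (2 + M)) * (t - t')) * (1 + runningLipP Ω U t') := by
  -- The sum of the two rates lets a single step length meet both smallness conditions. It depends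
  -- on `M` but not on `N`, so the final bound is free of `N`.
  set r := (L * (1 + M) + β) + 2 * L * (2 + M) with hr
  have hr0 : 0 ≤ r := by positivity
  obtain ⟨n, hn⟩ := exists_nat_gt (2 * r * (t - t'))
  have hn1 : (0 : ℝ) < n + 1 := by positivity
  set h := (t - t') / (n + 1) with hh
  have hh0 : 0 ≤ h := div_nonneg (by linarith) hn1.le
  have hnh : (n + 1) * h = t - t' := by rw [hh]; field_simp
  have hrh : r * h ≤ 1 / 2 := by
    rw [hh, mul_div_assoc', div_le_iff₀ hn1]
    linarith
  have h1 : (L * (1 + M) + β) * h ≤ 1 / 2 := by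
    refine le_trans ?_ hrh
    gcongr
    rw [hr]
    exact le_add_of_nonneg_right (by positivity)
  have h2 : 2 * L * (2 + M) * h ≤ 1 / 2 := by
    refine le_trans ?_ hrh
    gcongr
    rw [hr]
    exact le_add_of_nonneg_left (by positivity)
  have hind : ∀ j : ℕ, j ≤ n + 1 → 1 + runningLipP Ω U (t' + j * h) ≤
      Real.exp ((β + 4 * L * (2 + M)) * (j * h)) * (1 + runningLipP Ω U t') := by
    intro j
    induction j with
    | zero => intro _; simp
    | succ j ih =>
      intro hj
      have hle : t' + j * h + h ≤ t := by
        have : ((j : ℝ) + 1) * h ≤ (n + 1) * h := by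
          gcongr
          exact_mod_cast Nat.le_of_succ_le_succ hj
        linarith
      have hstep := one_add_runningLipP_step hΩ hW hL hβ hk hM hN hF hG hb hU₀ hU
        (t := t' + j * h) (h := h) (by positivity) hh0 (by linarith)
        (fun s hs => hUM s ⟨hs.1, hs.2.trans hle⟩) (hUN.mono hle le_rfl) h1 h2
      have e : t' + ((j + 1 : ℕ) : ℝ) * h = t' + j * h + h := by push_cast; ring
      rw [e]
      refine hstep.trans ?_
      calc _ ≤ Real.exp ((β + 4 * L * (2 + M)) * h) *
            (Real.exp ((β + 4 * L * (2 + M)) * (j * h)) * (1 + runningLipP Ω U t')) := by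
            gcongr
            exact ih (by omega)
        _ = _ := by
            rw [← mul_assoc, ← Real.exp_add]
            congr 2
            push_cast; ring
  have := hind (n + 1) le_rfl
  push_cast at this
  rw [hnh] at this
  simpa using this

end Growth

/-! ### The main estimate -/

section Constants

variable {d m : ℕ} {Ω : Set (EuclideanSpace ℝ (Fin d))}

lemma LipschitzOnWith.norm_sub_le_add {E F H : Type*} [NormedAddCommGroup E]
    [NormedAddCommGroup F] [NormedAddCommGroup H] {s : Set E} {K : ℝ≥0} {f : E → F → H}
    (h : LipschitzOnWith K (fun z : E × F => f z.1 z.2) (s ×ˢ univ)) {x x' : E} (hx : x ∈ s)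
    (hx' : x' ∈ s) (p p' : F) : ‖f x p - f x' p'‖ ≤ K * (‖x - x'‖ + ‖p - p'‖) := by
  have := h.dist_le_mul (x, p) (by simpa using hx) (x', p') (by simpa using hx')
  rw [Prod.dist_eq, dist_eq_norm, dist_eq_norm, dist_eq_norm] at this
  refine this.trans (mul_le_mul_of_nonneg_left ?_ K.2)
  exact max_le_add_of_nonneg (norm_nonneg _) (norm_nonneg _)

lemma LipThree.of_lipschitzOnWith {K : ℝ≥0} {L : ℝ}
    {F : EuclideanSpace ℝ (Fin d) → EuclideanSpace ℝ (Fin m) → EuclideanSpace ℝ (Fin d) →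
      EuclideanSpace ℝ (Fin d)}
    (h : LipschitzOnWith K
      (fun z : EuclideanSpace ℝ (Fin d) × EuclideanSpace ℝ (Fin m) × EuclideanSpace ℝ (Fin d) =>
        F z.1 z.2.1 z.2.2) (Ω ×ˢ univ)) (hKL : K ≤ L) : LipThree Ω L F := by
  intro x hx x' hx' p p' u u'
  refine (h.norm_sub_le_add (f := fun x (z : _ × _) => F x z.1 z.2) hx hx' (p, u) (p', u')).trans ?_
  have h1 : ‖(p, u) - (p', u')‖ ≤ ‖p - p'‖ + ‖u - u'‖ :=
    max_le_add_of_nonneg (norm_nonneg _) (norm_nonneg _)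
  have hL : 0 ≤ L := K.2.trans hKL
  rw [add_assoc]
  gcongr

end Constants

theorem mainTheorem7 {d m : ℕ} {S : Type*} [MeasurableSpace S] (P : Measure S)
    [IsProbabilityMeasure P]
    (hP : ∃ W : ℝ≥0 → S → EuclideanSpace ℝ (Fin m), IsBrownianMotion W P)
    (Ω : Set (EuclideanSpace ℝ (Fin d))) (hΩo : IsOpen Ω) (hΩc : IsConnected Ω)
    (hΩb : Bornology.IsBounded Ω)
    (σ : ℝ) (hσ : 0 ≤ σ)
    (F G : EuclideanSpace ℝ (Fin d) → EuclideanSpace ℝ (Fin m) → EuclideanSpace ℝ (Fin d) →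
      EuclideanSpace ℝ (Fin d))
    (b : EuclideanSpace ℝ (Fin m) → EuclideanSpace ℝ (Fin m))
    (U₀ : EuclideanSpace ℝ (Fin d) → EuclideanSpace ℝ (Fin m) → EuclideanSpace ℝ (Fin d))
    (hF : ∃ K : ℝ≥0, LipschitzOnWith K
      (fun z : EuclideanSpace ℝ (Fin d) × EuclideanSpace ℝ (Fin m) × EuclideanSpace ℝ (Fin d) =>
        F z.1 z.2.1 z.2.2) (Ω ×ˢ univ))
    (hG : ∃ K : ℝ≥0, LipschitzOnWith K
      (fun z : EuclideanSpace ℝ (Fin d) × EuclideanSpace ℝ (Fin m) × EuclideanSpace ℝ (Fin d) =>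
        G z.1 z.2.1 z.2.2) (Ω ×ˢ univ))
    (hb : ∃ K : ℝ≥0, LipschitzWith K b)
    (hU₀ : ∃ K : ℝ≥0, LipschitzOnWith K
      (fun z : EuclideanSpace ℝ (Fin d) × EuclideanSpace ℝ (Fin m) => U₀ z.1 z.2) (Ω ×ˢ univ))
    (T : ℝ) (hT : 0 < T) :
    ∃ C : ℝ, 0 < C ∧
      ∀ U : ℝ → EuclideanSpace ℝ (Fin d) → EuclideanSpace ℝ (Fin m) → EuclideanSpace ℝ (Fin d),
        IsLipschitzSolution P Ω σ b F G U₀ T U →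
        ∀ t ∈ Ico 0 T,
          (⨆ s ∈ Icc 0 t, lipX Ω (U s)) ≠ ∞ ∧
          (⨆ s ∈ Icc 0 t, lipP Ω (U s)) ≤
            ENNReal.ofReal
              (C * (1 + Real.exp (t * (⨆ s ∈ Icc 0 t, lipX Ω (U s)).toReal))) := by
  obtain ⟨W, hW⟩ := hP
  obtain ⟨K₁, hF⟩ := hF
  obtain ⟨K₂, hG⟩ := hG
  obtain ⟨β, hb⟩ := hb
  obtain ⟨k, hk⟩ := hU₀
  set L : ℝ := K₁ + K₂ with hL
  have hL0 : 0 ≤ L := by positivity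
  have hF3 : LipThree Ω L F := .of_lipschitzOnWith hF (by rw [hL]; linarith [K₂.2])
  have hG3 : LipThree Ω L G := .of_lipschitzOnWith hG (by rw [hL]; linarith [K₁.2])
  have hbβ : ∀ p p', ‖b p - b p'‖ ≤ β * ‖p - p'‖ := fun p p' => by
    simpa only [dist_eq_norm] using hb.dist_le_mul p p'
  have hU₀k : ∀ x ∈ Ω, ∀ x' ∈ Ω, ∀ p p', ‖U₀ x p - U₀ x' p'‖ ≤ k * (‖x - x'‖ + ‖p - p'‖) :=
    fun x hx x' hx' p p' => hk.norm_sub_le_add hx hx' p p'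
  have hLip : ∀ U, IsLipschitzSolution P Ω σ b F G U₀ T U → ∀ α ∈ Ico 0 T,
      ∃ K : ℝ, 0 ≤ K ∧ LipOn Ω α K K U := by
    intro U hU α hα
    obtain ⟨K, hK⟩ := hU.lipschitz α hα
    refine ⟨K, K.2, fun s hs x hx x' hx' p p' => ?_⟩
    rw [← mul_add]
    exact (hK s hs).norm_sub_le_add hx hx' p p'
  -- The constant is read off one fixed solution `V`; if there is none, any positive constant works.
  by_cases hex : ∃ V, IsLipschitzSolution P Ω σ b F G U₀ T V
  swap
  · exact ⟨1, one_pos, fun U hU => absurd ⟨U, hU⟩ hex⟩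
  obtain ⟨V, hV⟩ := hex
  -- beyond `T'`, the rate `4 * L * M` integrates to at most `t * M`
  obtain ⟨T', hT', hLT'⟩ : ∃ T' ∈ Ico 0 T, 4 * L * (T - T') = T' := by
    have h1 : 0 < 4 * L + 1 := by positivity
    refine ⟨4 * L * T / (4 * L + 1), ⟨by positivity, ?_⟩, by field_simp; ring⟩
    rw [div_lt_iff₀ h1]
    linarith
  obtain ⟨Kₛ, hKₛ, hVK⟩ := hLip V hV T' hT'
  -- Uniqueness on `[0, T']` gives every solution the Lipschitz constant of `V`. The constant of `U`
  -- itself is used to prove uniqueness but does not survive in the result.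
  have hshort : ∀ U, IsLipschitzSolution P Ω σ b F G U₀ T U → LipLast Ω U T' Kₛ := by
    intro U hU
    obtain ⟨K, hK, hUK⟩ := hLip U hU T' hT'
    have huniq := feynmanKac_unique hΩb hW hL0 β.2 k.2 (add_nonneg hK hKₛ) hT' hF3 hG3 hbβ hU₀k
      hU.feynmanKac hV.feynmanKac
      (fun s hs x hx x' hx' p p' => (hUK s hs x hx x' hx' p p').trans (by gcongr <;> linarith))
      (fun s hs x hx x' hx' p p' => (hVK s hs x hx x' hx' p p').trans (by gcongr <;> linarith))
    intro s hs x hx p q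
    rw [huniq s hs x hx, huniq s hs x hx]
    simpa using hVK s hs x hx x hx p q
  -- The factor `1 + Kₛ` bounds the state at time `T'`. The exponential collects the part `β + 8 *
  -- L` of the rate `β + 4 * L * (2 + M)` that does not involve `M`.
  refine ⟨Real.exp ((β + 8 * L) * T) * (1 + Kₛ), by positivity, fun U hU t ht => ?_⟩
  obtain ⟨K, hK, hUK⟩ := hLip U hU t ht
  have hfin : (⨆ s ∈ Icc 0 t, lipX Ω (U s)) ≠ ∞ :=
    ne_top_of_le_ne_top (ENNReal.ofReal_ne_top (r := K)) <| iSup₂_le fun s hs =>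
      (lipX_le_iff hK).2 fun x hx y hy p => by simpa using hUK s hs x hx y hy p p
  refine ⟨hfin, ?_⟩
  set M := (⨆ s ∈ Icc 0 t, lipX Ω (U s)).toReal with hM
  have hM0 : 0 ≤ M := ENNReal.toReal_nonneg
  have hUM : ∀ s ∈ Icc 0 t, ∀ x ∈ Ω, ∀ x' ∈ Ω, ∀ p, ‖U s x p - U s x' p‖ ≤ M * ‖x - x'‖ := by
    intro s hs
    refine (lipX_le_iff hM0).1 ?_
    rw [hM, ENNReal.ofReal_toReal hfin]
    exact le_iSup₂ (f := fun s _ => lipX Ω (U s)) s hs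
  have hUN : LipLast Ω U t K := fun s hs x hx p q => by simpa using hUK s hs x hx x hx p q
  have hC1 : 1 ≤ Real.exp ((β + 8 * L) * T) := Real.one_le_exp (by positivity)
  have he : 0 < Real.exp (t * M) := Real.exp_pos _
  rcases le_total t T' with htT | htT
  · refine (((hshort U hU).mono htT le_rfl).iSup_le hKₛ).trans (ENNReal.ofReal_le_ofReal ?_)
    calc Kₛ ≤ 1 * (1 + Kₛ) * (1 + 0) := by linarith
      _ ≤ _ := by gcongr
  · refine ((hUN.lipLast_runningLipP hK).iSup_le ENNReal.toReal_nonneg).trans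
      (ENNReal.ofReal_le_ofReal ?_)
    have hgrow := one_add_runningLipP_le hΩo hW hL0 β.2 k.2 hM0 hK hF3 hG3 hbβ hU₀k
      hU.feynmanKac hT'.1 htT ht.2 hUM hUN
    have hexp : (β + 4 * L * (2 + M)) * (t - T') ≤ (β + 8 * L) * T + t * M := by
      have h1 : (β + 8 * L) * (t - T') ≤ (β + 8 * L) * T := by
        gcongr
        linarith [ht.2, hT'.1]
      -- By the choice of `T'` the left side is at most `T'`, hence at most `t`; this turns the rate
      -- `4 * L * M` into the exponent `t * M`.
      have h2 : 4 * L * (t - T') ≤ t := by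
        have : 4 * L * (t - T') ≤ 4 * L * (T - T') := by
          gcongr
          exact ht.2.le
        linarith
      linarith [mul_le_mul_of_nonneg_right h2 hM0]
    have hgrow' : 1 + runningLipP Ω U t ≤
        Real.exp ((β + 8 * L) * T) * Real.exp (t * M) * (1 + Kₛ) := by
      rw [← Real.exp_add]
      refine hgrow.trans ?_
      have h0 : 0 ≤ runningLipP Ω U T' := ENNReal.toReal_nonneg
      gcongr ?_ * (1 + ?_)
      · exact Real.exp_le_exp.2 hexp
      · exact (hshort U hU).runningLipP_le hKₛ
    have hpos : 0 ≤ Real.exp ((β + 8 * L) * T) * (1 + Kₛ) := by positivity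
    change runningLipP Ω U t ≤ _
    linarith
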